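/- Let $\mathcal P$ be the set of partitions of $\mathbb N=\{1,2,\ldots\}$, with the $\sigma$-algebra generated by the events "$i,j$ are in the same block". An (exchangeable) homogeneous fragmentation process is a $\mathcal P$-valued process $\Pi=(\Pi(t),t\ge 0)$ with $\Pi(0)=\{\mathbb N\}$, whose paths are refining and right-continuous, whose law is invariant under permutations of $\mathbb N$, and which is Markov with transition kernel $(K_s)_{s\ge 0}$, where $K_s(\{B_i,i\ge 1\},\cdot\,)$ is the law of the partition with blocks $B_i\cap\Pi^{i}(s)$, $i\ge 1$, for independent copies $\Pi^{1},\Pi^{2},\ldots$ of $\Pi$. A path in $\Pi$ is a process $A=(A_t,t\ge 0)$ of subsets of $\mathbb N$ that is decreasing in $t$ and satisfies $A_t\in\Pi(t)$ for all $t\ge 0$. It is a Markovian path if there is a filtration $(\mathcal F_t,t\ge 0)$ to which $A$ and $\Pi$ are adapted and with respect to which $\Pi$ is Markovian, such that for each $s\ge 0$ the process $((A_t,\Pi(t)\cap A_s),t\ge s)$ and the restriction of $(\Pi(t),t\ge s)$ to $\mathbb N\setminus A_s$ are conditionally independent given $\mathcal F_s$. **Lemma (Spinal decomposition).** Let $A$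 be a Markovian path in a homogeneous fragmentation process $\Pi$. For $n\ge 1$ let $\Pi^{(n)}(t)$ be the block of $\Pi(t)$ containing $n$, with $\Pi^{(n)}(\infty)=\bigcap_{t\ge 0}\Pi^{(n)}(t)$, and let $\sigma_n=\inf\{t\ge 0\colon n\notin A_t\}\in[0,\infty]$, with $\inf\varnothing=\infty$. For $t\ge 0$ let $$\Pi^A(t)=\{\Pi^{(n)}(\sigma_n+t),\ n\ge 1\}.$$ Then $\Pi^A(t)$ is a partition of $\mathbb N$, and, writing $\Pi^A(0)=\{\Pi^A_i(0),i\ge 1\}$ for the spinal partition and $\Pi(\infty)$ for the partition with blocks $\Pi^{(n)}(\infty)$, $n\ge 1$, $$\Pi^A(t)=\bigcup_{i\ge 1}\Pi(\sigma_{\min\Pi^A_i(0)}+t)\cap\Pi^A_i(0),\qquad t\ge 0.$$ Moreover, conditionally given $\Pi^A(0)$ and $(\sigma_n,n\ge 1)$, the process $(\Pi^A(t),t\ge 0)$ is a fragmentation process starting from $\Pi^A(0)$ with the same transition kernel as $\Pi$: its paths are right-continuous and refining and, for all $s,t\ge 0$, the conditional law of $\Pi^A(s+t)$ given $\Pi^A(0)$,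 $(\sigma_n,n\ge 1)$ and $(\Pi^A(u),0\le u\le s)$ is $K_t(\Pi^A(s),\cdot\,)$. -/

import Mathlib

open MeasureTheory ProbabilityTheory Filter Topology
open scoped ENNReal NNReal

noncomputable section

namespace HomFrag

/-! Partitions of `ℕ` are represented by equivalence relations (`Setoid ℕ`), ordered by refinement
(`π ≤ ρ` means that `π` is finer than `ρ`, and `⊤` is the partition with the single block `ℕ`).
Labels start at `0` instead of `1`. -/

/-- The Borel `σ`-algebra of the space of partitions of `ℕ`, generated by the events
`{i and j are in the same block}`. -/
instance instMeasurableSpacePartition : MeasurableSpace (Setoid ℕ) :=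
  MeasurableSpace.comap (fun (π : Setoid ℕ) (i j : ℕ) => π.r i j) inferInstance

/-- The block of `π` that contains `n`. -/
def block (π : Setoid ℕ) (n : ℕ) : Set ℕ := {m | π.r m n}

/-- The least element of the block of `π` that contains `n`. -/
def least (π : Setoid ℕ) (n : ℕ) : ℕ := sInf (block π n)

theorem least_congr (π : Setoid ℕ) {i j : ℕ} (h : π.r i j) : least π i = least π j := by
  have hb : block π i = block π j := by
    ext m
    exact ⟨fun hm => π.trans' hm h, fun hm => π.trans' hm (π.symm' h)⟩
  rw [least, least, hb]

/-- The partition whose blocks are the non-empty sets among the blocks of `B ∩ x (min B)`, for `B`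
a block of `π`: every block `B` is split by its own partition, the one with index `min B`. -/
def fragment (π : Setoid ℕ) (x : ℕ → Setoid ℕ) : Setoid ℕ where
  r i j := π.r i j ∧ (x (least π i)).r i j
  iseqv :=
    { refl := fun i => ⟨π.refl' i, (x (least π i)).refl' i⟩
      symm := fun {i j} h => ⟨π.symm' h.1, by
        rw [← least_congr π h.1]; exact (x (least π i)).symm' h.2⟩
      trans := fun {i j k} h h' => ⟨π.trans' h.1 h'.1, by
        have h2 := h'.2
        rw [← least_congr π h.1] at h2
        exact (x (least π i)).trans' h.2 h2⟩ }

theorem measurable_fragment (π : Setoid ℕ) : Measurable (fragment π) := by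
  refine measurable_comap_iff.2 (measurable_pi_iff.2 fun i => measurable_pi_iff.2 fun j => ?_)
  have h : Measurable fun x : ℕ → Setoid ℕ => (x (least π i)).r i j :=
    ((measurable_pi_apply j).comp ((measurable_pi_apply i).comp
      (comap_measurable (fun (ρ : Setoid ℕ) (i j : ℕ) => ρ.r i j)))).comp
        (measurable_pi_apply (least π i))
  exact measurable_const.and h

/-- The restriction of a partition to a subset `B` of `ℕ`, as a relation on `B`. -/
def restrict (π : Setoid ℕ) (B : Set ℕ) : Set (ℕ × ℕ) :=
  {p | p.1 ∈ B ∧ p.2 ∈ B ∧ π.r p.1 p.2}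

/-- The value at a time in `[0, ∞]` of a path of refining partitions. At time `∞` two labels are
in the same block if they are so at all finite times. -/
def atTime (p : ℝ≥0 → Setoid ℕ) (t : ℝ≥0∞) : Setoid ℕ :=
  if t = ∞ then ⨅ s, p s else p t.toNNReal

/-- Right-continuity of a path of partitions: for every pair of labels (equivalently, for every
restriction to a finite set of labels) the path is constant on some `[t, t + ε)`. -/
def IsRightContinuous (p : ℝ≥0 → Setoid ℕ) : Prop :=
  ∀ (t : ℝ≥0) (i j : ℕ), ∀ᶠ u in 𝓝[≥] t, ((p u).r i j ↔ (p t).r i j)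

variable {Ω : Type*}

/-- The `σ`-algebra generated by `X u`, `u ≤ s`. -/
@[reducible]
def past (X : ℝ≥0 → Ω → Setoid ℕ) (s : ℝ≥0) : MeasurableSpace Ω :=
  ⨆ (u : ℝ≥0) (_ : u ≤ s), MeasurableSpace.comap (X u) inferInstance

/-- The transition kernel attached to a process `Y`: the law of the partition with blocks
`B ∩ Y⁽ᴮ⁾(t)`, for `B` a block of `π`, where the `Y⁽ᴮ⁾` are independent copies of `Y`. -/
def transitionKernel [MeasurableSpace Ω] (μ : Measure Ω) (Y : ℝ≥0 → Ω → Setoid ℕ)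
    (t : ℝ≥0) (π : Setoid ℕ) : Measure (Setoid ℕ) :=
  (Measure.infinitePi fun _ : ℕ => μ.map (Y t)).map (fragment π)

/-- Conditionally given the `σ`-algebra `𝒢`, the process `X` is a right-continuous refining Markov
process of partitions of `ℕ` (in its own filtration) with transition kernel `K`.
With `𝒢 = ⊥` this is the unconditional statement. -/
structure IsFragmentationGiven [mΩ : MeasurableSpace Ω] (μ : Measure Ω) (𝒢 : MeasurableSpace Ω)
    (K : ℝ≥0 → Setoid ℕ → Measure (Setoid ℕ)) (X : ℝ≥0 → Ω → Setoid ℕ) : Prop where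
  le : 𝒢 ≤ mΩ
  measurable : ∀ t, Measurable[mΩ] (X t)
  refining : ∀ ω, Antitone fun t => X t ω
  rightContinuous : ∀ ω, IsRightContinuous fun t => X t ω
  markov : ∀ (s t : ℝ≥0) (S : Set (Setoid ℕ)), MeasurableSet S →
    μ⟦X (s + t) ⁻¹' S | 𝒢 ⊔ past X s⟧ =ᵐ[μ] fun ω => (K t (X s ω)).real S

/-- Exchangeable homogeneous fragmentation processes started from the one-block partition. -/
structure IsHomogeneousFragmentation [MeasurableSpace Ω] (μ : Measure Ω)
    (Y : ℝ≥0 → Ω → Setoid ℕ) : Prop where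
  zero : ∀ ω, Y 0 ω = ⊤
  branching : IsFragmentationGiven μ ⊥ (transitionKernel μ Y) Y
  exchangeable : ∀ e : Equiv.Perm ℕ,
    μ.map (fun ω (t : ℝ≥0) => (Y t ω).comap e) = μ.map (fun ω (t : ℝ≥0) => Y t ω)

/-- Conditional independence of the `σ`-algebras `m₁` and `m₂` given `m'` (as in Mathlib's
`condIndep_iff`, without its restriction to standard Borel spaces). -/
def CondIndependent [MeasurableSpace Ω] (μ : Measure Ω) (m' m₁ m₂ : MeasurableSpace Ω) : Prop :=
  ∀ S T : Set Ω, MeasurableSet[m₁] S → MeasurableSet[m₂] T →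
    μ⟦S ∩ T | m'⟧ =ᵐ[μ] μ⟦S | m'⟧ * μ⟦T | m'⟧

/-- `A` is a path in `Y`: a decreasing process of blocks of `Y`. -/
structure IsPath (Y : ℝ≥0 → Ω → Setoid ℕ) (A : ℝ≥0 → Ω → Set ℕ) : Prop where
  mem : ∀ t ω, A t ω ∈ (Y t ω).classes
  decreasing : ∀ ω, Antitone fun t => A t ω

/-- The `σ`-algebra generated by the process `((A t, Y t ∩ A s), t ≥ s)`. -/
@[reducible]
def insideFuture (Y : ℝ≥0 → Ω → Setoid ℕ) (A : ℝ≥0 → Ω → Set ℕ) (s : ℝ≥0) : MeasurableSpace Ω :=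
  ⨆ (t : ℝ≥0) (_ : s ≤ t),
    MeasurableSpace.comap (fun ω => (A t ω, restrict (Y t ω) (A s ω))) inferInstance

/-- The `σ`-algebra generated by the restriction of `(Y t, t ≥ s)` to `ℕ \ A s`. -/
@[reducible]
def outsideFuture (Y : ℝ≥0 → Ω → Setoid ℕ) (A : ℝ≥0 → Ω → Set ℕ) (s : ℝ≥0) : MeasurableSpace Ω :=
  ⨆ (t : ℝ≥0) (_ : s ≤ t),
    MeasurableSpace.comap (fun ω => restrict (Y t ω) (A s ω)ᶜ) inferInstance

/-- `A` is a Markovian path in `Y`. -/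
def IsMarkovianPath [mΩ : MeasurableSpace Ω] (μ : Measure Ω)
    (Y : ℝ≥0 → Ω → Setoid ℕ) (A : ℝ≥0 → Ω → Set ℕ) : Prop :=
  IsPath Y A ∧ ∃ 𝓕 : Filtration ℝ≥0 mΩ,
    Adapted 𝓕 A ∧ Adapted 𝓕 Y ∧
    (∀ (s t : ℝ≥0) (S : Set (Setoid ℕ)), MeasurableSet S →
      μ⟦Y (s + t) ⁻¹' S | 𝓕 s⟧ =ᵐ[μ]
        μ⟦Y (s + t) ⁻¹' S | MeasurableSpace.comap (Y s) inferInstance⟧) ∧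
    ∀ s : ℝ≥0, CondIndependent μ (𝓕 s) (insideFuture Y A s) (outsideFuture Y A s)

/-- The exit time `inf {t ≥ 0 : n ∉ A t}` of the label `n`, with `inf ∅ = ∞`. -/
def exitTime (A : ℝ≥0 → Ω → Set ℕ) (n : ℕ) (ω : Ω) : ℝ≥0∞ :=
  ⨅ (t : ℝ≥0) (_ : n ∉ A t ω), (t : ℝ≥0∞)

/-- The block containing `n` of `Y` at time `t` after the exit time of `n`. -/
def spinalBlock (Y : ℝ≥0 → Ω → Setoid ℕ) (A : ℝ≥0 → Ω → Set ℕ) (t : ℝ≥0) (ω : Ω) (n : ℕ) :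
    Set ℕ :=
  block (atTime (fun s => Y s ω) (exitTime A n ω + t)) n

/-- The spinal process: `n` and `m` are in the same block at time `t` if their spinal blocks at time
`t` are equal. -/
def spinal (Y : ℝ≥0 → Ω → Setoid ℕ) (A : ℝ≥0 → Ω → Set ℕ) (t : ℝ≥0) (ω : Ω) : Setoid ℕ :=
  Setoid.ker (spinalBlock Y A t ω)

/-- The `σ`-algebra generated by the spinal partition and all the exit times. -/
@[reducible]
def spinalSigma (Y : ℝ≥0 → Ω → Setoid ℕ) (A : ℝ≥0 → Ω → Set ℕ) : MeasurableSpace Ω :=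
  MeasurableSpace.comap (fun ω => (spinal Y A 0 ω, fun n : ℕ => exitTime A n ω)) inferInstance

end HomFrag

end

/-! The definition of a Markovian path gives information at deterministic times `s` only: given the
past and the future inside `A s`, the part of `Y` outside `A s` is still split by the fragmentation
kernel. The spinal process restarts labels at random times that differ from label to label. The
proof discretizes time, so that exits happen at countably many deterministic times, and then lets
the mesh tend to `0`.

On a grid of mesh `h`, let `P` be the law of `Y h`, and fix a finite set of labels and their exit
indices. Exits up to step `v` belong to the past, later ones to the future inside the spine, so the
whole exit configuration is known when one conditions at step `v`. Labels with different exit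
indices lie in different blocks once the earlier group has left, and disjoint blocks are split
independently (`act_mul`, `act_prod`). Integrating out one step at a time, from a late horizon back
to the exit of each group, gives a product over the groups of backward recursions
(`lintegral_exitEvent_step`, `lintegral_exitEvent_prod`). Each recursion absorbs its last factor
into the kernel (`back_congr_step`), which is the one-step Markov property of the spinal chain given
the exit indices (`lintegral_exitEvent_markov`). Labels that never leave form one group that stays
together. A pair of labels stays together along the whole grid with probability `0`, unless `P`
almost surely does not separate it (`IsHomogeneousFragmentation.dichotomy`), so this group is
harmless.

Several steps follow from the semigroup property: composing two fragmentation kernels can be checked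
on the one-block partition (`fragKer_comp`).

In the limit, grid exit times decrease to the true ones in the sense of convergence from the right,
and every event about finitely many pairs stabilizes by right-continuity
(`eventually_gridSpinal_rel`). The kernel is continuous along such limits, so dominated convergence
gives the Markov identity on cylinder events (`IsGridSpine.lintegral_spinalEvent`), and a `π`-system
argument extends it to the conditioning `σ`-algebra. The partition statements are pathwise: labels
in a common spinal block have a common exit time (`exitTime_eq_of_rel`). -/

namespace HomFrag

/-! ### Cylinder events, restrictions of partitions and measurability -/

section Partitions

theorem measurableSet_rel (i j : ℕ) : MeasurableSet {π : Setoid ℕ | π.r i j} :=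
  measurableSet_setOfPred.2 ((measurable_pi_apply j).comp ((measurable_pi_apply i).comp
    (comap_measurable (fun (ρ : Setoid ℕ) (i j : ℕ) => ρ.r i j))))

theorem measurable_of_rel {α : Type*} [MeasurableSpace α] {f : α → Setoid ℕ}
    (h : ∀ i j, MeasurableSet {a | (f a).r i j}) : Measurable f :=
  measurable_comap_iff.2 (measurable_pi_iff.2 fun i => measurable_pi_iff.2 fun j =>
    measurableSet_setOfPred.1 (h i j))

theorem least_rel (π : Setoid ℕ) (i : ℕ) : π.r (least π i) i :=
  Nat.sInf_mem (s := block π i) ⟨i, π.refl' i⟩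

theorem least_eq_iff (π : Setoid ℕ) {i j : ℕ} : least π i = least π j ↔ π.r i j := by
  refine ⟨fun h => ?_, least_congr π⟩
  have h1 := least_rel π i
  rw [h] at h1
  exact π.trans' (π.symm' h1) (least_rel π j)

theorem least_top (i : ℕ) : least ⊤ i = 0 := by
  have : (0 : ℕ) ∈ block ⊤ i := trivial
  exact Nat.sInf_eq_zero.2 (Or.inl this)

/-- The partitions in which all the pairs of `F` are related. -/
def agree (F : Finset (ℕ × ℕ)) : Set (Setoid ℕ) := {π | ∀ p ∈ F, π.r p.1 p.2}

theorem measurableSet_agree (F : Finset (ℕ × ℕ)) : MeasurableSet (agree F) := by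
  have : agree F = ⋂ p ∈ F, {π : Setoid ℕ | π.r p.1 p.2} := by ext; simp [agree]
  rw [this]
  exact F.measurableSet_biInter fun p _ => measurableSet_rel _ _

theorem agree_union (F F' : Finset (ℕ × ℕ)) : agree (F ∪ F') = agree F ∩ agree F' := by
  ext π
  simp only [agree, Finset.mem_union, Set.mem_ofPred_eq, Set.mem_inter_iff]
  exact ⟨fun h => ⟨fun p hp => h p (Or.inl hp), fun p hp => h p (Or.inr hp)⟩,
    fun h p hp => hp.elim (h.1 p) (h.2 p)⟩

theorem isPiSystem_range_agree : IsPiSystem (Set.range agree) := by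
  rintro _ ⟨F, rfl⟩ _ ⟨F', rfl⟩ _
  exact ⟨F ∪ F', agree_union F F'⟩

theorem generateFrom_range_agree :
    instMeasurableSpacePartition = MeasurableSpace.generateFrom (Set.range agree) := by
  apply le_antisymm
  · have : Measurable[MeasurableSpace.generateFrom (Set.range agree)] (id : Setoid ℕ → Setoid ℕ) := by
      refine @measurable_of_rel _ (MeasurableSpace.generateFrom (Set.range agree)) _ fun i j => ?_
      refine MeasurableSpace.measurableSet_generateFrom ⟨{(i, j)}, ?_⟩
      ext π
      simp [agree]
    exact fun s hs => this hs
  · refine MeasurableSpace.generateFrom_le ?_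
    rintro _ ⟨F, rfl⟩
    exact measurableSet_agree F

/-- Finite measures on partitions are determined by the events that given pairs are related. -/
theorem ext_agree {ν ν' : Measure (Setoid ℕ)} [IsFiniteMeasure ν]
    (h : ∀ F, ν (agree F) = ν' (agree F)) : ν = ν' := by
  refine ext_of_generate_finite _ generateFrom_range_agree isPiSystem_range_agree ?_ ?_
  · rintro _ ⟨F, rfl⟩
    exact h F
  · have := h ∅
    rwa [show agree ∅ = Set.univ by ext; simp [agree]] at this

/-- The partition that agrees with `π` on `C` and has singletons as its other blocks. -/
def keep (C : Set ℕ) (π : Setoid ℕ) : Setoid ℕ where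
  r i j := i = j ∨ (i ∈ C ∧ j ∈ C ∧ π.r i j)
  iseqv :=
    { refl := fun i => Or.inl rfl
      symm := by
        rintro i j (h | ⟨h1, h2, h3⟩)
        · exact Or.inl h.symm
        · exact Or.inr ⟨h2, h1, π.symm' h3⟩
      trans := by
        rintro i j k (rfl | ⟨h1, h2, h3⟩) h'
        · exact h'
        · rcases h' with rfl | ⟨h1', h2', h3'⟩
          · exact Or.inr ⟨h1, h2, h3⟩
          · exact Or.inr ⟨h1, h2', π.trans' h3 h3'⟩ }

theorem keep_rel {C : Set ℕ} {π : Setoid ℕ} {i j : ℕ} :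
    (keep C π).r i j ↔ i = j ∨ (i ∈ C ∧ j ∈ C ∧ π.r i j) := Iff.rfl

theorem setoid_ext {π ρ : Setoid ℕ} (h : ∀ i j, π.r i j ↔ ρ.r i j) : π = ρ :=
  Setoid.ext h

theorem keep_congr {C : Set ℕ} {π ρ : Setoid ℕ} (h : ∀ i ∈ C, ∀ j ∈ C, π.r i j ↔ ρ.r i j) :
    keep C π = keep C ρ := by
  refine setoid_ext fun i j => ?_
  rw [keep_rel, keep_rel]
  refine or_congr Iff.rfl ?_
  constructor
  · rintro ⟨h1, h2, h3⟩
    exact ⟨h1, h2, (h i h1 j h2).1 h3⟩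
  · rintro ⟨h1, h2, h3⟩
    exact ⟨h1, h2, (h i h1 j h2).2 h3⟩

/-- `f` depends only on the restriction of a partition to `C`. -/
def LocalTo {β : Type*} (C : Set ℕ) (f : Setoid ℕ → β) : Prop := ∀ π, f (keep C π) = f π

theorem LocalTo.congr {β : Type*} {C : Set ℕ} {f : Setoid ℕ → β} (hf : LocalTo C f)
    {π ρ : Setoid ℕ} (h : ∀ i ∈ C, ∀ j ∈ C, π.r i j ↔ ρ.r i j) : f π = f ρ := by
  rw [← hf π, ← hf ρ, keep_congr h]

theorem localTo_of_congr {β : Type*} {C : Set ℕ} {f : Setoid ℕ → β}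
    (h : ∀ π ρ : Setoid ℕ, (∀ i ∈ C, ∀ j ∈ C, π.r i j ↔ ρ.r i j) → f π = f ρ) : LocalTo C f :=
  fun π => h _ _ fun i hi j hj => by
    rw [keep_rel]
    constructor
    · rintro (rfl | h)
      · exact π.refl' _
      · exact h.2.2
    · exact fun h => Or.inr ⟨hi, hj, h⟩

theorem LocalTo.mono {β : Type*} {C D : Set ℕ} {f : Setoid ℕ → β} (hf : LocalTo C f)
    (h : C ⊆ D) : LocalTo D f :=
  localTo_of_congr fun _ _ hπ => hf.congr fun i hi j hj => hπ i (h hi) j (h hj)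

theorem LocalTo.mul {C : Set ℕ} {f g : Setoid ℕ → ℝ≥0∞} (hf : LocalTo C f) (hg : LocalTo C g) :
    LocalTo C (fun π => f π * g π) := fun π => by simp only [hf π, hg π]

theorem LocalTo.prod {ι : Type*} {C : Set ℕ} {f : ι → Setoid ℕ → ℝ≥0∞} {s : Finset ι}
    (hf : ∀ i ∈ s, LocalTo C (f i)) : LocalTo C (fun π => ∏ i ∈ s, f i π) :=
  fun π => Finset.prod_congr rfl fun i hi => hf i hi π

theorem localTo_const {β : Type*} (C : Set ℕ) (b : β) : LocalTo C fun _ => b := fun _ => rfl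

theorem localTo_agree {C : Set ℕ} {F : Finset (ℕ × ℕ)} (h : ∀ p ∈ F, p.1 ∈ C ∧ p.2 ∈ C) :
    LocalTo C ((agree F).indicator (1 : Setoid ℕ → ℝ≥0∞)) := by
  refine localTo_of_congr fun π ρ hπ => ?_
  have : π ∈ agree F ↔ ρ ∈ agree F :=
    forall₂_congr fun p hp => hπ _ (h p hp).1 _ (h p hp).2
  by_cases hπ : π ∈ agree F
  · rw [Set.indicator_of_mem hπ, Set.indicator_of_mem (this.1 hπ)]; rfl
  · rw [Set.indicator_of_notMem hπ, Set.indicator_of_notMem (mt this.2 hπ)]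

theorem measurable_least (i : ℕ) : Measurable fun π : Setoid ℕ => least π i := by
  have h : ∀ m, MeasurableSet {π : Setoid ℕ | least π i = m} := by
    intro m
    have : {π : Setoid ℕ | least π i = m} =
        {π : Setoid ℕ | π.r m i} ∩ ⋂ j ∈ Finset.range m, {π : Setoid ℕ | π.r j i}ᶜ := by
      ext π
      simp only [Set.mem_ofPred_eq, Set.mem_inter_iff, Set.mem_iInter, Finset.mem_range,
        Set.mem_compl_iff]
      constructor
      · rintro rfl
        exact ⟨least_rel π i, fun j hj => Nat.notMem_of_lt_sInf (s := block π i) hj⟩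
      · rintro ⟨h1, h2⟩
        refine le_antisymm (Nat.sInf_le (s := block π i) h1) ?_
        by_contra! hlt
        exact h2 _ hlt (least_rel π i)
    rw [this]
    exact (measurableSet_rel _ _).inter
      (Finset.measurableSet_biInter _ fun j _ => (measurableSet_rel _ _).compl)
  exact measurable_to_countable' h

theorem fragment_rel {π : Setoid ℕ} {x : ℕ → Setoid ℕ} {i j : ℕ} :
    (fragment π x).r i j ↔ π.r i j ∧ (x (least π i)).r i j := Iff.rfl

theorem fragment_le (π : Setoid ℕ) (x : ℕ → Setoid ℕ) : fragment π x ≤ π := fun _ _ h => h.1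

theorem fragment_top (x : ℕ → Setoid ℕ) : fragment ⊤ x = x 0 := by
  refine setoid_ext fun i j => ?_
  rw [fragment_rel, least_top]
  exact and_iff_right trivial

theorem measurable_uncurry_fragment :
    Measurable fun p : Setoid ℕ × (ℕ → Setoid ℕ) => fragment p.1 p.2 := by
  refine measurable_of_rel fun i j => ?_
  have : {p : Setoid ℕ × (ℕ → Setoid ℕ) | (fragment p.1 p.2).r i j} =
      {p | p.1.r i j} ∩ ⋃ m, ({p | least p.1 i = m} ∩ {p | (p.2 m).r i j}) := by
    ext p
    simp [fragment_rel]
  rw [this]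
  refine (measurable_fst (measurableSet_rel i j)).inter (MeasurableSet.iUnion fun m => ?_)
  exact ((measurable_least i).comp measurable_fst (measurableSet_singleton m)).inter
    ((((measurable_pi_apply m).comp measurable_snd) :
      Measurable fun p : Setoid ℕ × (ℕ → Setoid ℕ) => p.2 m) (measurableSet_rel i j))

end Partitions

/-! ### Fragmentation kernels: locality, independence of disjoint blocks, composition -/

section Kernel

variable (P : Measure (Setoid ℕ)) [IsProbabilityMeasure P]

/-- The kernel that splits the blocks of a partition by independent partitions with law `P`. -/
noncomputable def fragKer : Kernel (Setoid ℕ) (Setoid ℕ) where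
  toFun π := (Measure.infinitePi fun _ : ℕ => P).map (fragment π)
  measurable' := by
    refine Measure.measurable_of_measurable_coe _ fun S hS => ?_
    simp_rw [Measure.map_apply (measurable_fragment _) hS]
    exact measurable_measure_prodMk_left (measurable_uncurry_fragment hS)

theorem fragKer_apply (π : Setoid ℕ) :
    fragKer P π = (Measure.infinitePi fun _ : ℕ => P).map (fragment π) := rfl

instance : IsMarkovKernel (fragKer P) :=
  ⟨fun π => by
    rw [fragKer_apply]
    exact Measure.isProbabilityMeasure_map (measurable_fragment π).aemeasurable⟩

theorem lintegral_fragKer (π : Setoid ℕ) {f : Setoid ℕ → ℝ≥0∞} (hf : Measurable f) :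
    ∫⁻ ρ, f ρ ∂fragKer P π = ∫⁻ x, f (fragment π x) ∂(Measure.infinitePi fun _ : ℕ => P) := by
  rw [fragKer_apply, lintegral_map hf (measurable_fragment π)]

theorem fragKer_top : fragKer P ⊤ = P := by
  rw [fragKer_apply, show fragment ⊤ = fun x : ℕ → Setoid ℕ => x 0 from funext fragment_top]
  exact Measure.infinitePi_map_eval (fun _ : ℕ => P) 0

/-- The kernel from `π` is carried by refinements of `π`, so only the values of a function there
matter. -/
theorem lintegral_fragKer_congr (π : Setoid ℕ) {f : Setoid ℕ → ℝ≥0∞} (hf : Measurable f)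
    {g : Setoid ℕ → ℝ≥0∞} (hg : Measurable g) (h : ∀ ρ ≤ π, f ρ = g ρ) :
    ∫⁻ ρ, f ρ ∂fragKer P π = ∫⁻ ρ, g ρ ∂fragKer P π := by
  rw [lintegral_fragKer P π hf, lintegral_fragKer P π hg]
  exact lintegral_congr fun x => h _ (fragment_le π x)

/-- The action of a fragmentation kernel on non-negative functions. -/
noncomputable def act (f : Setoid ℕ → ℝ≥0∞) (π : Setoid ℕ) : ℝ≥0∞ := ∫⁻ ρ, f ρ ∂fragKer P π

theorem measurable_act {f : Setoid ℕ → ℝ≥0∞} (hf : Measurable f) : Measurable (act P f) :=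
  hf.lintegral_kernel

/-- The law of the fragmentation of `π`, restricted to `C`, depends only on `π` restricted to
`C`. -/
theorem LocalTo.act {C : Set ℕ} {f : Setoid ℕ → ℝ≥0∞} (hf : LocalTo C f) (hfm : Measurable f) :
    LocalTo C (act P f) := by
  refine localTo_of_congr fun π ρ h => ?_
  rw [HomFrag.act, HomFrag.act, lintegral_fragKer P π hfm, lintegral_fragKer P ρ hfm]
  let S : Set ℕ := least π '' C
  have hS : ∀ s : S, ∃ i ∈ C, least π i = s := fun s => s.2
  choose r hrC hr using hS
  -- A block that meets `C` may have its least element outside `C`, so its index can differ for `π`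
  -- and `ρ`. Passing from one index to the other is an injective relabelling, which preserves the
  -- law of an i.i.d. family.
  let θ : S → ℕ := fun s => least ρ (r s)
  have hθ : ∀ i (hi : i ∈ C), θ ⟨least π i, Set.mem_image_of_mem _ hi⟩ = least ρ i := by
    intro i hi
    refine (least_eq_iff ρ).2 ((h _ (hrC _) _ hi).1 ((least_eq_iff π).1 ?_))
    exact hr _
  have hinj : Function.Injective θ := by
    intro s s' hss
    have := (least_eq_iff π).2 ((h _ (hrC _) _ (hrC _)).2 ((least_eq_iff ρ).1 hss))
    rw [hr, hr] at this
    exact Subtype.ext this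
  classical
  -- The value `⊤` is never read: on `C` the fragmented partition uses indices in `S` only.
  let ext : (S → Setoid ℕ) → ℕ → Setoid ℕ := fun z n => if hn : n ∈ S then z ⟨n, hn⟩ else ⊤
  have hext : Measurable ext := by
    refine measurable_pi_iff.2 fun n => ?_
    by_cases hn : n ∈ S
    · simp only [ext, hn, dif_pos]
      exact measurable_pi_apply _
    · simp only [ext, hn, dif_neg, not_false_eq_true]
      exact measurable_const
  let g : (S → Setoid ℕ) → ℝ≥0∞ := fun z => f (fragment π (ext z))
  have hg : Measurable g := hfm.comp ((measurable_fragment π).comp hext)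
  have h1 : ∀ x : ℕ → Setoid ℕ, f (fragment π x) = g fun s => x s := by
    intro x
    refine hf.congr fun i hi j hj => ?_
    rw [fragment_rel, fragment_rel,
      show ext (fun s => x s) (least π i) = x (least π i) from
        dif_pos (Set.mem_image_of_mem _ hi)]
  have h2 : ∀ x : ℕ → Setoid ℕ, f (fragment ρ x) = g fun s => x (θ s) := by
    intro x
    refine hf.congr fun i hi j hj => ?_
    rw [fragment_rel, fragment_rel, h i hi j hj,
      show ext (fun s => x (θ s)) (least π i) = x (least ρ i) from
        (dif_pos (Set.mem_image_of_mem _ hi)).trans (congrArg x (hθ i hi))]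
  simp_rw [h1, h2]
  have e1 := Measure.map_infinitePi_infinitePi_of_inj (P := fun _ : ℕ => P)
    (f := ((↑) : S → ℕ)) Subtype.val_injective
  have e2 := Measure.map_infinitePi_infinitePi_of_inj (P := fun _ : ℕ => P) (f := θ) hinj
  rw [← lintegral_map hg (g := fun (x : ℕ → Setoid ℕ) (s : S) => x s) (by fun_prop), e1,
    ← lintegral_map hg (g := fun (x : ℕ → Setoid ℕ) (s : S) => x (θ s)) (by fun_prop), e2]

/-- Unions of blocks that are disjoint are split independently. -/
theorem act_mul {C D : Set ℕ} {f g : Setoid ℕ → ℝ≥0∞} (hf : LocalTo C f) (hfm : Measurable f)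
    (hg : LocalTo D g) (hgm : Measurable g) {π : Setoid ℕ}
    (hπ : ∀ i ∈ C, ∀ j ∈ D, ¬ π.r i j) :
    act P (fun ρ => f ρ * g ρ) π = act P f π * act P g π := by
  rw [act, act, act, lintegral_fragKer P π (f := fun ρ => f ρ * g ρ) (hfm.mul hgm), lintegral_fragKer P π hfm,
    lintegral_fragKer P π hgm]
  let m : ℕ → MeasurableSpace (ℕ → Setoid ℕ) := fun n =>
    MeasurableSpace.comap (fun x => x n) inferInstance
  have hm : ∀ n, m n ≤ MeasurableSpace.pi := fun n => (measurable_pi_apply n).comap_le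
  have hind : iIndep m (Measure.infinitePi fun _ : ℕ => P) :=
    (iIndepFun_infinitePi (P := fun _ : ℕ => P) (X := fun _ x => x)
      (fun _ => measurable_id)).iIndep
  have hdisj : Disjoint (least π '' C) (least π '' D) := by
    rw [Set.disjoint_left]
    rintro _ ⟨i, hi, rfl⟩ ⟨j, hj, hij⟩
    exact hπ i hi j hj ((least_eq_iff π).1 hij.symm)
  have hloc : ∀ (E : Set ℕ) (u : Setoid ℕ → ℝ≥0∞), LocalTo E u → Measurable u →
      Measurable[⨆ n ∈ least π '' E, m n] fun x => u (fragment π x) := by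
    intro E u hu hum
    -- The full partition `fragment π x` depends on all coordinates; after `keep E`, only those of
    -- the blocks that meet `E` remain.
    have : (fun x => u (fragment π x)) = fun x => u (keep E (fragment π x)) := by
      funext x
      exact (hu _).symm
    rw [this]
    refine @Measurable.comp _ _ _ (⨆ n ∈ least π '' E, m n) _ _ _ _ hum ?_
    refine @measurable_of_rel _ (⨆ n ∈ least π '' E, m n) _ fun i j => ?_
    have hset : {x : ℕ → Setoid ℕ | (keep E (fragment π x)).r i j} =
        {x | i = j ∨ (i ∈ E ∧ j ∈ E ∧ π.r i j ∧ (x (least π i)).r i j)} := rfl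
    rw [hset]
    by_cases hij : i = j
    · simp [hij]
    by_cases hi : i ∈ E ∧ j ∈ E ∧ π.r i j
    · have : {x : ℕ → Setoid ℕ | i = j ∨ (i ∈ E ∧ j ∈ E ∧ π.r i j ∧ (x (least π i)).r i j)} =
          (fun x : ℕ → Setoid ℕ => x (least π i)) ⁻¹' {ρ | ρ.r i j} := by
        ext x
        exact ⟨fun h => (h.resolve_left hij).2.2.2, fun h => Or.inr ⟨hi.1, hi.2.1, hi.2.2, h⟩⟩
      rw [this]
      have hle : m (least π i) ≤ ⨆ n ∈ least π '' E, m n :=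
        le_iSup₂_of_le (least π i) (Set.mem_image_of_mem _ hi.1) le_rfl
      exact hle _ ⟨_, measurableSet_rel i j, rfl⟩
    · have : {x : ℕ → Setoid ℕ | i = j ∨ (i ∈ E ∧ j ∈ E ∧ π.r i j ∧ (x (least π i)).r i j)} =
          ∅ := by
        ext x
        exact ⟨fun h => hi ⟨(h.resolve_left hij).1, (h.resolve_left hij).2.1,
          (h.resolve_left hij).2.2.1⟩, fun h => h.elim⟩
      rw [this]
      exact @MeasurableSet.empty _ (⨆ n ∈ least π '' E, m n)
  exact lintegral_mul_eq_lintegral_mul_lintegral_of_independent_measurableSpace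
    (iSup₂_le fun n _ => hm n) (iSup₂_le fun n _ => hm n)
    (indep_iSup_of_disjoint hm hind hdisj) (hloc C f hf hfm) (hloc D g hg hgm)

theorem act_prod {ι : Type*} (s : Finset ι) (C : ι → Set ℕ) (f : ι → Setoid ℕ → ℝ≥0∞)
    (hf : ∀ a ∈ s, LocalTo (C a) (f a)) (hfm : ∀ a ∈ s, Measurable (f a)) {π : Setoid ℕ}
    (hπ : ∀ a ∈ s, ∀ b ∈ s, a ≠ b → ∀ i ∈ C a, ∀ j ∈ C b, ¬ π.r i j) :
    act P (fun ρ => ∏ a ∈ s, f a ρ) π = ∏ a ∈ s, act P (f a) π := by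
  classical
  induction s using Finset.induction_on with
  | empty => simp [act]
  | insert a s ha ih =>
    simp_rw [Finset.prod_insert ha]
    rw [act_mul P (C := C a) (D := ⋃ b ∈ s, C b) (hf a (Finset.mem_insert_self a s))
      (hfm a (Finset.mem_insert_self a s)), ih]
    · exact fun b hb => hf b (Finset.mem_insert_of_mem hb)
    · exact fun b hb => hfm b (Finset.mem_insert_of_mem hb)
    · exact fun b hb b' hb' => hπ b (Finset.mem_insert_of_mem hb) b' (Finset.mem_insert_of_mem hb')
    · exact LocalTo.prod fun b hb => (hf b (Finset.mem_insert_of_mem hb)).mono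
        (Set.subset_biUnion_of_mem (u := C) hb)
    · exact Finset.measurable_prod _ fun b hb => hfm b (Finset.mem_insert_of_mem hb)
    · intro i hi j hj
      obtain ⟨b, hb, hjb⟩ := Set.mem_iUnion₂.1 hj
      exact hπ a (Finset.mem_insert_self a s) b (Finset.mem_insert_of_mem hb)
        (fun h => ha (h ▸ hb)) i hi j hjb

theorem act_one (π : Setoid ℕ) : act P (fun _ => 1) π = 1 := by
  simp [act]

theorem act_indicator {S : Set (Setoid ℕ)} (hS : MeasurableSet S) (π : Setoid ℕ) :
    act P (S.indicator 1) π = fragKer P π S := by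
  rw [act, lintegral_indicator_one hS]

/-- The part of `F` that lies in the block of `π` with least element `b`. -/
noncomputable def inBlock (F : Finset (ℕ × ℕ)) (π : Setoid ℕ) (b : ℕ) : Finset (ℕ × ℕ) :=
  {p ∈ F | least π p.1 = b}

/-- Each pair is assigned to the block of its first label, so the pairs of `F` are distributed over
the blocks without any assumption that `π` relates them. -/
theorem prod_indicator_inBlock (F : Finset (ℕ × ℕ)) (π ρ : Setoid ℕ) :
    (agree F).indicator (1 : Setoid ℕ → ℝ≥0∞) ρ =
      ∏ b ∈ F.image (fun p => least π p.1),
        (agree (inBlock F π b)).indicator (1 : Setoid ℕ → ℝ≥0∞) ρ := by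
  by_cases h : ρ ∈ agree F
  · rw [Set.indicator_of_mem h, Finset.prod_eq_one]
    · rfl
    · intro b _
      rw [Set.indicator_of_mem]
      · rfl
      · exact fun p hp => h p (Finset.mem_filter.1 hp).1
  · rw [Set.indicator_of_notMem h]
    have h' : ∃ p ∈ F, ¬ ρ.r p.1 p.2 := by
      by_contra! h'
      exact h h'
    obtain ⟨p, hp, hpr⟩ := h'
    refine (Finset.prod_eq_zero (i := least π p.1) 
      (Finset.mem_image_of_mem (fun p : ℕ × ℕ => least π p.1) hp) ?_).symm
    rw [Set.indicator_of_notMem]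
    exact fun h => hpr (h p (Finset.mem_filter.2 ⟨hp, rfl⟩))

/-- Fragmenting by `P` and then by `Q` is the same as fragmenting by `R` if this is so for the
one-block partition. -/
theorem fragKer_comp {P Q R : Measure (Setoid ℕ)} [IsProbabilityMeasure P]
    [IsProbabilityMeasure Q] [IsProbabilityMeasure R] (h : R = P.bind (fragKer Q))
    (π : Setoid ℕ) : fragKer R π = (fragKer P π).bind (fragKer Q) := by
  refine ext_agree fun F => ?_
  have hF := measurableSet_agree F
  rw [Measure.bind_apply hF (Kernel.aemeasurable _), ← act_indicator R hF]
  simp_rw [← act_indicator Q hF]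
  change _ = act P (act Q ((agree F).indicator 1)) π
  have hmi : ∀ F : Finset (ℕ × ℕ), Measurable ((agree F).indicator (1 : Setoid ℕ → ℝ≥0∞)) :=
    fun F => measurable_one.indicator (measurableSet_agree F)
  by_cases hπ : π ∈ agree F
  · let C : ℕ → Set ℕ := fun b => {i | least π i = b}
    have hC : ∀ b, ∀ p ∈ inBlock F π b, p.1 ∈ C b ∧ p.2 ∈ C b := by
      intro b p hp
      obtain ⟨hpF, hpb⟩ := Finset.mem_filter.1 hp
      exact ⟨hpb, ((least_eq_iff π).2 (π.symm' (hπ p hpF))).trans hpb⟩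
    have hloc : ∀ b, LocalTo (C b) ((agree (inBlock F π b)).indicator (1 : Setoid ℕ → ℝ≥0∞)) :=
      fun b => localTo_agree (hC b)
    have hsep : ∀ ρ ≤ π, ∀ a b, a ≠ b → ∀ i ∈ C a, ∀ j ∈ C b, ¬ ρ.r i j := by
      intro ρ hρ a b hab i hi j hj hij
      have := (least_eq_iff π).2 (hρ hij)
      exact hab ((show least π i = a from hi).symm.trans (this.trans hj))
    -- Seen from within one of its blocks, `π` is the one-block partition; this reduces each factor
    -- to the hypothesis `h`.
    have htop : ∀ b (f : Setoid ℕ → ℝ≥0∞), LocalTo (C b) f → f π = f ⊤ := by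
      intro b f hf
      refine hf.congr fun i hi j hj => ⟨fun _ => trivial, fun _ => ?_⟩
      exact (least_eq_iff π).1 ((show least π i = b from hi).trans (show least π j = b from hj).symm)
    have hfun : (agree F).indicator (1 : Setoid ℕ → ℝ≥0∞) = fun ρ =>
        ∏ b ∈ F.image (fun p => least π p.1), (agree (inBlock F π b)).indicator 1 ρ :=
      funext fun ρ => prod_indicator_inBlock F π ρ
    have e1 : act R ((agree F).indicator 1) π =
        ∏ b ∈ F.image (fun p => least π p.1), act R ((agree (inBlock F π b)).indicator 1) π := by
      conv_lhs => rw [hfun]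
      exact act_prod R _ C _ (fun b _ => hloc b) (fun b _ => hmi _)
        fun a _ b _ hab => hsep π le_rfl a b hab
    have e2 : act P (act Q ((agree F).indicator 1)) π =
        act P (fun ρ => ∏ b ∈ F.image (fun p => least π p.1),
          act Q ((agree (inBlock F π b)).indicator 1) ρ) π := by
      refine lintegral_fragKer_congr P π (measurable_act Q (hmi F))
        (Finset.measurable_prod _ fun b _ => measurable_act Q (hmi _)) fun ρ hρ => ?_
      conv_lhs => rw [hfun]
      exact act_prod Q _ C _ (fun b _ => hloc b) (fun b _ => hmi _)
        fun a _ b _ hab => hsep ρ hρ a b hab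
    rw [e1, e2, act_prod P _ C _ (fun b _ => (hloc b).act Q (hmi _))
      (fun b _ => measurable_act Q (hmi _)) fun a _ b _ hab => hsep π le_rfl a b hab]
    refine Finset.prod_congr rfl fun b _ => ?_
    rw [htop b _ ((hloc b).act R (hmi _)),
      htop b _ (((hloc b).act Q (hmi _)).act P (measurable_act Q (hmi _)))]
    have hm := measurableSet_agree (inBlock F π b)
    rw [act_indicator R hm, act, fragKer_top, fragKer_top, h,
      Measure.bind_apply hm (Kernel.aemeasurable _)]
    exact lintegral_congr fun ρ => (act_indicator Q hm ρ).symm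
  -- A pair separated by `π` remains separated under refinement, so both sides vanish.
  · have hz : ∀ (Q : Measure (Setoid ℕ)) [IsProbabilityMeasure Q], ∀ ρ ≤ π,
        act Q ((agree F).indicator 1) ρ = 0 := by
      intro Q _ ρ hρ
      have : act Q ((agree F).indicator 1) ρ = ∫⁻ _, 0 ∂fragKer Q ρ := by
        refine lintegral_fragKer_congr Q ρ (hmi F) measurable_const fun ρ' hρ' => ?_
        exact Set.indicator_of_notMem (fun h : ∀ p ∈ F, ρ'.r p.1 p.2 =>
          hπ fun p hp => hρ (hρ' (h p hp))) _
      simpa using this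
    rw [hz R π le_rfl]
    have : act P (act Q ((agree F).indicator 1)) π = ∫⁻ _, 0 ∂fragKer P π :=
      lintegral_fragKer_congr P π (measurable_act Q (hmi F)) measurable_const fun ρ hρ => hz Q ρ hρ
    rw [this]
    simp

end Kernel

/-! ### Pathwise properties of exit times and of the spinal partition -/

section Deterministic

theorem atTime_top (p : ℝ≥0 → Setoid ℕ) : atTime p ∞ = ⨅ s, p s := if_pos rfl

theorem atTime_coe (p : ℝ≥0 → Setoid ℕ) (t : ℝ≥0) : atTime p t = p t := by
  rw [atTime, if_neg ENNReal.coe_ne_top, ENNReal.toNNReal_coe]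

theorem iInf_rel (p : ℝ≥0 → Setoid ℕ) (i j : ℕ) : (⨅ s, p s).r i j ↔ ∀ s, (p s).r i j := by
  change (sInf (Set.range p)) i j ↔ _
  rw [Setoid.sInf_def]
  simp

theorem antitone_atTime {p : ℝ≥0 → Setoid ℕ} (hp : Antitone p) : Antitone (atTime p) := by
  intro a b hab
  induction b with
  | top =>
    rw [atTime_top]
    induction a with
    | top => rw [atTime_top]
    | coe a => rw [atTime_coe]; exact iInf_le _ _
  | coe b =>
    lift a to ℝ≥0 using ne_top_of_le_ne_top ENNReal.coe_ne_top hab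
    rw [atTime_coe, atTime_coe]
    exact hp (ENNReal.coe_le_coe.1 hab)

theorem tendsto_const_add_nhdsGE (a t : ℝ≥0) :
    Tendsto (fun u => a + u) (𝓝[≥] t) (𝓝[≥] (a + t)) := by
  refine tendsto_nhdsWithin_iff.2 ⟨?_, ?_⟩
  · exact ((continuous_const.add continuous_id).tendsto t).mono_left nhdsWithin_le_nhds
  · filter_upwards [self_mem_nhdsWithin] with u hu
    exact add_le_add le_rfl (Set.mem_Ici.1 hu)

theorem eventually_atTime_add {p : ℝ≥0 → Setoid ℕ} (hp : IsRightContinuous p) (a : ℝ≥0∞)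
    (t : ℝ≥0) (i j : ℕ) :
    ∀ᶠ u : ℝ≥0 in 𝓝[≥] t, ((atTime p (a + u)).r i j ↔ (atTime p (a + t)).r i j) := by
  induction a with
  | top => exact Eventually.of_forall fun u => by rw [top_add, top_add]
  | coe a =>
    filter_upwards [(tendsto_const_add_nhdsGE a t).eventually (hp (a + t) i j)] with u hu
    rwa [← ENNReal.coe_add, ← ENNReal.coe_add, atTime_coe, atTime_coe]

variable {Ω : Type*} {Y : ℝ≥0 → Ω → Setoid ℕ} {A : ℝ≥0 → Ω → Set ℕ}

theorem IsPath.mem_iff_rel (hA : IsPath Y A) {t : ℝ≥0} {ω : Ω} {m n : ℕ} (hm : m ∈ A t ω) :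
    n ∈ A t ω ↔ (Y t ω).r n m := by
  obtain ⟨y, hy⟩ := hA.mem t ω
  rw [hy] at hm ⊢
  have hm' : (Y t ω).r m y := hm
  exact ⟨fun h => (Y t ω).trans' h ((Y t ω).symm' hm'), fun h => (Y t ω).trans' h hm'⟩

/-- The path inherits right-continuity from `Y`: a label `m` of `A (t + 1)` lies in `A u` for every
`u ≤ t + 1`, so membership of `n` in `A u` reduces to being in the block of `m` at time `u`. -/
theorem IsPath.eventually_mem (hA : IsPath Y A)
    (hr : ∀ ω, IsRightContinuous fun t => Y t ω) {t : ℝ≥0} {ω : Ω} {n : ℕ} (hn : n ∈ A t ω) :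
    ∀ᶠ u in 𝓝[≥] t, n ∈ A u ω := by
  obtain ⟨m, hm⟩ : (A (t + 1) ω).Nonempty := by
    obtain ⟨y, hy⟩ := hA.mem (t + 1) ω
    exact ⟨y, hy ▸ (Y (t + 1) ω).refl' y⟩
  have hmt : m ∈ A t ω := hA.decreasing ω le_self_add hm
  have hlt : ∀ᶠ u in 𝓝[≥] t, u < t + 1 :=
    nhdsWithin_le_nhds (Iio_mem_nhds (lt_add_of_pos_right t one_pos))
  filter_upwards [hr ω t n m, hlt] with u hu hut
  exact (hA.mem_iff_rel (hA.decreasing ω hut.le hm)).2 (hu.2 ((hA.mem_iff_rel hmt).1 hn))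

/-- By right-continuity a label has already left at its exit time, hence the strict inequality. -/
theorem IsPath.mem_iff_lt_exitTime (hA : IsPath Y A)
    (hr : ∀ ω, IsRightContinuous fun t => Y t ω) {t : ℝ≥0} {ω : Ω} {n : ℕ} :
    n ∈ A t ω ↔ (t : ℝ≥0∞) < exitTime A n ω := by
  constructor
  · intro hn
    have h1 : ∀ᶠ u in 𝓝[>] t, n ∈ A u ω :=
      nhdsWithin_mono t Set.Ioi_subset_Ici_self (hA.eventually_mem hr hn)
    obtain ⟨u, hu, htu⟩ := (h1.and self_mem_nhdsWithin).exists
    refine (ENNReal.coe_lt_coe.2 (Set.mem_Ioi.1 htu)).trans_le (le_iInf₂ fun v hv => ?_)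
    refine ENNReal.coe_le_coe.2 ?_
    by_contra! hvu
    exact hv (hA.decreasing ω hvu.le hu)
  · intro h
    by_contra hn
    exact absurd (iInf₂_le t hn) (not_le.2 h)

variable (hA : IsPath Y A) (ha : ∀ ω, Antitone fun t => Y t ω)
  (hr : ∀ ω, IsRightContinuous fun t => Y t ω)

include hA ha hr

/-- Blocks only get finer, so two labels together at or after the exit time of `i` were together
throughout the time before it, and the path, being made of blocks, contains both or neither. -/
theorem exitTime_eq_of_rel {t : ℝ≥0} {ω : Ω} {i j : ℕ}
    (h : (atTime (fun s => Y s ω) (exitTime A i ω + t)).r j i) :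
    exitTime A j ω = exitTime A i ω := by
  induction hi : exitTime A i ω with
  | top =>
    rw [hi, top_add, atTime_top, iInf_rel] at h
    refine ENNReal.eq_top_of_forall_nnreal_le fun u => ?_
    refine ((hA.mem_iff_lt_exitTime hr).1 ((hA.mem_iff_rel ?_).2 (h u))).le
    exact (hA.mem_iff_lt_exitTime hr).2 (hi ▸ ENNReal.coe_lt_top)
  | coe v =>
    rw [hi, ← ENNReal.coe_add, atTime_coe] at h
    have hv : ∀ u ≤ v, (Y u ω).r j i := fun u hu => ha ω (hu.trans le_self_add) h
    have hmem : ∀ u ≤ v, (i ∈ A u ω ↔ j ∈ A u ω) := fun u hu =>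
      ⟨fun hi' => (hA.mem_iff_rel hi').2 (hv u hu),
        fun hj' => (hA.mem_iff_rel hj').2 ((Y u ω).symm' (hv u hu))⟩
    refine le_antisymm ?_ ?_
    · by_contra! hlt
      have := (hA.mem_iff_lt_exitTime hr).1 ((hmem v le_rfl).2 ((hA.mem_iff_lt_exitTime hr).2 hlt))
      rw [hi] at this
      exact lt_irrefl _ this
    · by_contra! hlt
      lift exitTime A j ω to ℝ≥0 using (hlt.trans ENNReal.coe_lt_top).ne with u hu
      have hiu : i ∈ A u ω := (hA.mem_iff_lt_exitTime hr).2 (hi ▸ hlt)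
      have := (hA.mem_iff_lt_exitTime hr).1 ((hmem u (ENNReal.coe_lt_coe.1 hlt).le).1 hiu)
      rw [← hu] at this
      exact lt_irrefl _ this

theorem spinal_rel {t : ℝ≥0} {ω : Ω} {i j : ℕ} :
    (spinal Y A t ω).r i j ↔ exitTime A i ω = exitTime A j ω ∧
      (atTime (fun s => Y s ω) (exitTime A j ω + t)).r i j := by
  have hker : (spinal Y A t ω).r i j ↔ spinalBlock Y A t ω i = spinalBlock Y A t ω j := Iff.rfl
  rw [hker]
  constructor
  · intro h
    have hi : i ∈ spinalBlock Y A t ω j := h ▸ Setoid.refl' _ i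
    exact ⟨exitTime_eq_of_rel hA ha hr hi, hi⟩
  · rintro ⟨h1, h2⟩
    ext m
    change (atTime (fun s => Y s ω) (exitTime A i ω + t)).r m i ↔
      (atTime (fun s => Y s ω) (exitTime A j ω + t)).r m j
    rw [h1]
    exact ⟨fun h => Setoid.trans' _ h h2, fun h => Setoid.trans' _ h (Setoid.symm' _ h2)⟩

theorem spinal_rel_iff_mem {t : ℝ≥0} {ω : Ω} {i j : ℕ} :
    (spinal Y A t ω).r i j ↔ i ∈ spinalBlock Y A t ω j := by
  rw [spinal_rel hA ha hr]
  exact ⟨fun h => h.2, fun h => ⟨exitTime_eq_of_rel hA ha hr h, h⟩⟩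

theorem classes_spinal (t : ℝ≥0) (ω : Ω) :
    (spinal Y A t ω).classes = Set.range (spinalBlock Y A t ω) := by
  have h : ∀ n, {x | (spinal Y A t ω).r x n} = spinalBlock Y A t ω n := by
    intro n
    ext m
    exact spinal_rel_iff_mem hA ha hr
  ext D
  constructor
  · rintro ⟨n, rfl⟩
    exact ⟨n, (h n).symm⟩
  · rintro ⟨n, rfl⟩
    exact ⟨n, (h n).symm⟩

theorem antitone_spinal (ω : Ω) : Antitone fun t => spinal Y A t ω := by
  intro s t hst i j h
  have h' := (spinal_rel hA ha hr).1 h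
  refine (spinal_rel hA ha hr).2 ⟨h'.1, antitone_atTime (ha ω) ?_ h'.2⟩
  exact add_le_add le_rfl (ENNReal.coe_le_coe.2 hst)

theorem isRightContinuous_spinal (ω : Ω) : IsRightContinuous fun t => spinal Y A t ω := by
  intro t i j
  filter_upwards [eventually_atTime_add (hr ω) (exitTime A j ω) t i j] with u hu
  rw [spinal_rel hA ha hr, spinal_rel hA ha hr, hu]

/-- All labels of a block `B` at time `0` share the exit time of `sInf B`. Hence inside `B` the
spinal relation at `t` is that of `Y` at one common time, and by refinement no spinal block leaves
`B`. -/
theorem classes_spinal_eq_iUnion (t : ℝ≥0) (ω : Ω) :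
    (spinal Y A t ω).classes = ⋃ B ∈ (spinal Y A 0 ω).classes, {D : Set ℕ | D.Nonempty ∧
      ∃ C ∈ (atTime (fun s => Y s ω) (exitTime A (sInf B) ω + t)).classes, D = C ∩ B} := by
  have hB : ∀ B ∈ (spinal Y A 0 ω).classes, ∀ n ∈ B,
      exitTime A n ω = exitTime A (sInf B) ω ∧ B = {x | (spinal Y A 0 ω).r x n} := by
    rintro B ⟨k, rfl⟩ n hn
    have hn' : (spinal Y A 0 ω).r n k := hn
    have hs : (spinal Y A 0 ω).r (sInf {x | (spinal Y A 0 ω).r x k}) k :=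
      Nat.sInf_mem (s := {x | (spinal Y A 0 ω).r x k}) ⟨n, hn⟩
    refine ⟨((spinal_rel hA ha hr).1 (Setoid.trans' _ hn' (Setoid.symm' _ hs))).1, ?_⟩
    ext x
    exact ⟨fun h => Setoid.trans' _ h (Setoid.symm' _ hn'), fun h => Setoid.trans' _ h hn'⟩
  have hle : ∀ i j, (spinal Y A t ω).r i j → (spinal Y A 0 ω).r i j := fun i j h =>
    antitone_spinal hA ha hr ω (zero_le : 0 ≤ t) h
  have hclass : ∀ B ∈ (spinal Y A 0 ω).classes, ∀ n ∈ B,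
      {x | (spinal Y A t ω).r x n} =
        {x | (atTime (fun s => Y s ω) (exitTime A (sInf B) ω + t)).r x n} ∩ B := by
    intro B hBc n hn
    obtain ⟨h1, h2⟩ := hB B hBc n hn
    ext x
    constructor
    · intro hx
      refine ⟨h1 ▸ ((spinal_rel hA ha hr).1 hx).2, ?_⟩
      rw [h2]
      exact hle _ _ hx
    · rintro ⟨hx1, hx2⟩
      rw [h2] at hx2
      refine (spinal_rel hA ha hr).2 ⟨((spinal_rel hA ha hr).1 hx2).1, ?_⟩
      rw [h1]
      exact hx1
  ext D
  rw [Set.mem_iUnion₂]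
  constructor
  · rintro ⟨n, rfl⟩
    have hBc : {x | (spinal Y A 0 ω).r x n} ∈ (spinal Y A 0 ω).classes := ⟨n, rfl⟩
    exact ⟨_, hBc, ⟨n, (spinal Y A t ω).refl' n⟩, _, ⟨n, rfl⟩,
      hclass _ hBc n ((spinal Y A 0 ω).refl' n)⟩
  · rintro ⟨B, hBc, ⟨m, hm⟩, C, ⟨k, rfl⟩, rfl⟩
    refine ⟨m, ?_⟩
    refine Eq.trans ?_ (hclass B hBc m hm.2).symm
    have hmk : (atTime (fun s => Y s ω) (exitTime A (sInf B) ω + t)).r m k := hm.1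
    congr 1
    ext x
    exact ⟨fun h => Setoid.trans' _ h (Setoid.symm' _ hmk), fun h => Setoid.trans' _ h hmk⟩

end Deterministic

/-! ### Discrete time: the spine chain, its exit indices and conditional splitting -/

section Chain

variable {Ω : Type*}

/-- The `σ`-algebra generated by `a w` and the restriction of `y w` to `a v`, for `w ≥ v`. -/
@[reducible]
def insideChain (y : ℕ → Ω → Setoid ℕ) (a : ℕ → Ω → Set ℕ) (v : ℕ) : MeasurableSpace Ω :=
  ⨆ (w : ℕ) (_ : v ≤ w),
    MeasurableSpace.comap (fun ω => (a w ω, keep (a v ω) (y w ω))) inferInstance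

theorem measurable_keep_insideChain (y : ℕ → Ω → Setoid ℕ) (a : ℕ → Ω → Set ℕ) {v w : ℕ}
    (hw : v ≤ w) : Measurable[insideChain y a v] fun ω => keep (a v ω) (y w ω) := by
  have h1 : Measurable[insideChain y a v] fun ω => (a w ω, keep (a v ω) (y w ω)) :=
    Measurable.mono (comap_measurable _) (le_iSup₂_of_le w hw le_rfl) le_rfl
  exact measurable_snd.comp h1

/-- A discrete-time refining chain of partitions `y` with step law `P` and a decreasing sequence
`a` of blocks of `y`, such that given the past and the future inside `a v` the part of `y` outside
`a v` is split by independent partitions with law `P`. -/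
structure IsSpineChain [mΩ : MeasurableSpace Ω] (μ : Measure Ω) (P : Measure (Setoid ℕ))
    [IsProbabilityMeasure P] (y : ℕ → Ω → Setoid ℕ) (a : ℕ → Ω → Set ℕ)
    (𝓕 : ℕ → MeasurableSpace Ω) : Prop where
  le : ∀ v, 𝓕 v ≤ mΩ
  mono : Monotone 𝓕
  measurable_y : ∀ v, Measurable[𝓕 v] (y v)
  measurable_a : ∀ v, Measurable[𝓕 v] (a v)
  antitone_y : ∀ ω, Antitone fun v => y v ω
  antitone_a : ∀ ω, Antitone fun v => a v ω
  mem_iff_rel : ∀ {v ω m n}, m ∈ a v ω → (n ∈ a v ω ↔ (y v ω).r n m)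
  split : ∀ (v : ℕ) (G : Set Ω), MeasurableSet[𝓕 v ⊔ insideChain y a v] G →
    ∀ F : Finset (ℕ × ℕ), (∀ ω ∈ G, ∀ p ∈ F, p.1 ∉ a v ω ∧ p.2 ∉ a v ω) →
      μ (G ∩ y (v + 1) ⁻¹' agree F) = ∫⁻ ω in G, fragKer P (y v ω) (agree F) ∂μ
  dichotomy : ∀ i j, P {π | π.r i j} = 1 ∨ μ {ω | ∀ v, (y v ω).r i j} = 0

/-- The first index at which the label `n` is not in `a`. -/
noncomputable def exitIndex (a : ℕ → Ω → Set ℕ) (n : ℕ) (ω : Ω) : ℕ∞ :=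
  ⨅ (v : ℕ) (_ : n ∉ a v ω), (v : ℕ∞)

theorem mem_iff_lt_exitIndex_of_antitone {a : ℕ → Ω → Set ℕ} {ω : Ω}
    (ha : Antitone fun v => a v ω) {v n : ℕ} : n ∈ a v ω ↔ (v : ℕ∞) < exitIndex a n ω := by
  constructor
  · intro hn
    have : ((v + 1 : ℕ) : ℕ∞) ≤ exitIndex a n ω := by
      refine le_iInf₂ fun w hw => ?_
      refine Nat.cast_le.2 ?_
      by_contra! hlt
      exact hw (ha (Nat.lt_succ_iff.1 hlt) hn)
    exact (Nat.cast_lt.2 (Nat.lt_succ_self v)).trans_le this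
  · intro hv
    by_contra hn
    exact absurd (iInf₂_le v hn) (not_le.2 hv)

/-- The chain of partitions in which every label starts its evolution at its exit index. -/
def spinalChain (y : ℕ → Ω → Setoid ℕ) (a : ℕ → Ω → Set ℕ) (l : ℕ) (ω : Ω) : Setoid ℕ where
  r i j := exitIndex a i ω = exitIndex a j ω ∧
    ∀ g : ℕ, exitIndex a i ω = g → (y (g + l) ω).r i j
  iseqv :=
    { refl := fun i => ⟨rfl, fun _ _ => Setoid.refl' _ i⟩
      symm := fun h => ⟨h.1.symm, fun g hg => Setoid.symm' _ (h.2 g (h.1.trans hg))⟩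
      trans := fun h h' => ⟨h.1.trans h'.1, fun g hg =>
        Setoid.trans' _ (h.2 g hg) (h'.2 g (h.1.symm.trans hg))⟩ }

theorem spinalChain_rel {y : ℕ → Ω → Setoid ℕ} {a : ℕ → Ω → Set ℕ} {l : ℕ} {ω : Ω} {i j : ℕ} :
    (spinalChain y a l ω).r i j ↔ exitIndex a i ω = exitIndex a j ω ∧
      ∀ g : ℕ, exitIndex a i ω = g → (y (g + l) ω).r i j := Iff.rfl

/-- The backward recursion for the expectation of a product of functions along the chain with
`r` remaining steps. -/
noncomputable def back (P : Measure (Setoid ℕ)) [IsProbabilityMeasure P]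
    (ψ : ℕ → Setoid ℕ → ℝ≥0∞) : ℕ → ℕ → Setoid ℕ → ℝ≥0∞
  | 0, w => ψ w
  | r + 1, w => fun π => ψ w π * act P (back P ψ r (w + 1)) π

section Back

variable (P : Measure (Setoid ℕ)) [IsProbabilityMeasure P] {ψ ψ' : ℕ → Setoid ℕ → ℝ≥0∞}

theorem measurable_back (hψ : ∀ w, Measurable (ψ w)) (r w : ℕ) : Measurable (back P ψ r w) := by
  induction r generalizing w with
  | zero => exact hψ w
  | succ r ih => exact (hψ w).mul (measurable_act P (ih (w + 1)))

theorem localTo_back {C : Set ℕ} (hψ : ∀ w, Measurable (ψ w)) (hC : ∀ w, LocalTo C (ψ w))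
    (r w : ℕ) : LocalTo C (back P ψ r w) := by
  induction r generalizing w with
  | zero => exact hC w
  | succ r ih => exact (hC w).mul ((ih (w + 1)).act P (measurable_back P hψ r (w + 1)))

theorem back_one (r w : ℕ) (h : ∀ w' ≥ w, ψ w' = fun _ => 1) : back P ψ r w = fun _ => 1 := by
  induction r generalizing w with
  | zero => exact h w le_rfl
  | succ r ih =>
    funext π
    simp only [back]
    rw [h w le_rfl, ih (w + 1) fun w' hw' => h w' (by omega), act_one, one_mul]

/-- Moving the last factor one step back along the chain does not change the recursion. -/
theorem back_congr_step {m : ℕ} (hlt : ∀ w < m, ψ w = ψ' w)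
    (hm : ψ' m = fun π => ψ m π * act P (ψ (m + 1)) π)
    (hψ : ∀ w > m + 1, ψ w = fun _ => 1) (hψ' : ∀ w > m, ψ' w = fun _ => 1) (r w : ℕ)
    (hw : w ≤ m) (hr : m < w + r) : back P ψ r w = back P ψ' r w := by
  induction r generalizing w with
  | zero => omega
  | succ r ih =>
    funext π
    simp only [back]
    rcases hw.lt_or_eq with hw | rfl
    · rw [hlt w hw, ih (w + 1) hw (by omega)]
    · rw [hm, back_one P r (w + 1) fun w' hw' => hψ' w' hw', act_one, mul_one]
      congr 2
      cases r with
      | zero => rfl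
      | succ r =>
        funext π
        simp only [back]
        rw [back_one P r (w + 1 + 1) fun w' hw' => hψ w' (by omega), act_one, mul_one]

end Back

namespace IsSpineChain

variable [mΩ : MeasurableSpace Ω] {μ : Measure Ω} {P : Measure (Setoid ℕ)}
  [IsProbabilityMeasure P] {y : ℕ → Ω → Setoid ℕ} {a : ℕ → Ω → Set ℕ}
  {𝓕 : ℕ → MeasurableSpace Ω} (h : IsSpineChain μ P y a 𝓕)

include h

theorem mem_iff_lt_exitIndex {v n : ℕ} {ω : Ω} : n ∈ a v ω ↔ (v : ℕ∞) < exitIndex a n ω :=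
  mem_iff_lt_exitIndex_of_antitone (h.antitone_a ω)

/-- At step `g` the label `j` is still in the block `a g` and `i` is not; refinement keeps them
apart afterwards. -/
theorem not_rel_of_exitIndex_lt {g v i j : ℕ} {ω : Ω} (hi : exitIndex a i ω = g)
    (hj : (g : ℕ∞) < exitIndex a j ω) (hv : g ≤ v) : ¬ (y v ω).r i j := by
  intro hij
  have hjg := h.mem_iff_lt_exitIndex.2 hj
  have := h.mem_iff_lt_exitIndex.1 ((h.mem_iff_rel hjg).2 (h.antitone_y ω hv hij))
  rw [hi] at this
  exact lt_irrefl _ this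

theorem not_rel_of_exitIndex_ne {g g' v i j : ℕ} {ω : Ω} (hi : exitIndex a i ω = g)
    (hj : exitIndex a j ω = g') (hne : g ≠ g') (hg : g ≤ v) (hg' : g' ≤ v) : ¬ (y v ω).r i j := by
  rcases lt_or_gt_of_ne hne with hlt | hlt
  · exact h.not_rel_of_exitIndex_lt hi (hj ▸ Nat.cast_lt.2 hlt) hg
  · exact fun hij => h.not_rel_of_exitIndex_lt hj (hi ▸ Nat.cast_lt.2 hlt) hg' (Setoid.symm' _ hij)

theorem insideChain_le (v : ℕ) : insideChain y a v ≤ mΩ := by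
  refine iSup₂_le fun w _ => Measurable.comap_le ?_
  refine Measurable.prodMk ((h.measurable_a w).mono (h.le w) le_rfl) ?_
  refine measurable_of_rel fun i j => ?_
  have hm : ∀ i, MeasurableSet {ω | i ∈ a v ω} := fun i => measurableSet_setOfPred.2
    (measurable_set_iff.1 ((h.measurable_a v).mono (h.le v) le_rfl) i)
  have hy : MeasurableSet {ω | (y w ω).r i j} :=
    (h.measurable_y w).mono (h.le w) le_rfl (measurableSet_rel i j)
  exact (MeasurableSet.const _).union ((hm i).inter ((hm j).inter hy))

theorem info_le (v : ℕ) : 𝓕 v ⊔ insideChain y a v ≤ mΩ := sup_le (h.le v) (h.insideChain_le v)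

/-- The spine is known up to `v` from the past and after `v` from the inside future. This is why one
may condition on all exit indices, including those of the future. -/
theorem measurable_a_info (v w : ℕ) : Measurable[𝓕 v ⊔ insideChain y a v] (a w) := by
  rcases le_total w v with hw | hw
  · exact (h.measurable_a w).mono ((h.mono hw).trans le_sup_left) le_rfl
  · have h1 : Measurable[insideChain y a v] fun ω => (a w ω, keep (a v ω) (y w ω)) :=
      Measurable.mono (comap_measurable _) (le_iSup₂_of_le w hw le_rfl) le_rfl
    exact (measurable_fst.comp h1).mono le_sup_right le_rfl

theorem measurableSet_exitIndex_eq {m : MeasurableSpace Ω} (ha : ∀ w, Measurable[m] (a w)) (n : ℕ)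
    (k : ℕ∞) : MeasurableSet[m] {ω | exitIndex a n ω = k} := by
  have hw : ∀ w, MeasurableSet[m] {ω | n ∈ a w ω} := fun w =>
    measurableSet_setOfPred.2 (measurable_set_iff.1 (ha w) n)
  have : {ω | exitIndex a n ω = k} = ⋂ w : ℕ, {ω | n ∈ a w ω ↔ (w : ℕ∞) < k} := by
    ext ω
    have hmem : ∀ w : ℕ, n ∈ a w ω ↔ (w : ℕ∞) < exitIndex a n ω := fun w =>
      mem_iff_lt_exitIndex (mΩ := mΩ) h
    simp only [Set.mem_ofPred_eq, Set.mem_iInter, hmem]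
    constructor
    · rintro rfl w
      exact Iff.rfl
    · intro hk
      refine le_antisymm ?_ ?_
      · refine ENat.forall_natCast_le_iff_le.1 fun w hw => ?_
        cases w with
        | zero => exact zero_le
        | succ w =>
          have := (hk w).1 ((Nat.cast_lt.2 (Nat.lt_succ_self w)).trans_le hw)
          exact Order.add_one_le_of_lt this
      · refine ENat.forall_natCast_le_iff_le.1 fun w hw => ?_
        cases w with
        | zero => exact zero_le
        | succ w =>
          have := (hk w).2 ((Nat.cast_lt.2 (Nat.lt_succ_self w)).trans_le hw)
          exact Order.add_one_le_of_lt this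
  rw [this]
  refine MeasurableSet.iInter fun w => ?_
  by_cases hwk : (w : ℕ∞) < k
  · simpa [hwk] using hw w
  · have : {ω | n ∈ a w ω ↔ (w : ℕ∞) < k} = {ω | n ∈ a w ω}ᶜ := by
      ext ω
      simp [hwk]
    rw [this]
    exact (hw w).compl

/-- Functions of the part outside `a v` can be replaced by their conditional expectation. -/
theorem lintegral_mul_split [IsFiniteMeasure μ] {v : ℕ} {D : Set ℕ} {G : Set Ω}
    (hG : MeasurableSet[𝓕 v ⊔ insideChain y a v] G) (hGD : ∀ ω ∈ G, ∀ i ∈ D, i ∉ a v ω)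
    {X : Ω → ℝ≥0∞} (hX : Measurable[𝓕 v ⊔ insideChain y a v] X) {f : Setoid ℕ → ℝ≥0∞}
    (hf : LocalTo D f) (hfm : Measurable f) :
    ∫⁻ ω in G, X ω * f (y (v + 1) ω) ∂μ = ∫⁻ ω in G, X ω * act P f (y v ω) ∂μ := by
  have hle := h.info_le v
  have hy : ∀ w, Measurable (y w) := fun w => (h.measurable_y w).mono (h.le w) le_rfl
  have hkeep : Measurable (keep D) := by
    refine measurable_of_rel fun i j => ?_
    exact (MeasurableSet.const _).union ((MeasurableSet.const _).inter
      ((MeasurableSet.const _).inter (measurableSet_rel i j)))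
  have hset : ∀ G' ⊆ G, MeasurableSet[𝓕 v ⊔ insideChain y a v] G' →
      ∫⁻ ω in G', f (y (v + 1) ω) ∂μ = ∫⁻ ω in G', act P f (y v ω) ∂μ := by
    intro G' hG'G hG'
    -- The field `split` controls only pairs outside `a v`, so the laws are compared after `keep D`,
    -- which loses nothing for a function local to `D`.
    have key : ((μ.restrict G').map (y (v + 1))).map (keep D) =
        (((μ.restrict G').map (y v)).bind (fragKer P)).map (keep D) := by
      refine ext_agree fun F => ?_
      have hFm := measurableSet_agree F
      rw [Measure.map_apply hkeep hFm, Measure.map_apply hkeep hFm,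
        Measure.map_apply (hy _) (hkeep hFm),
        Measure.bind_apply (hkeep hFm) (Kernel.aemeasurable _),
        lintegral_map ((fragKer P).measurable_coe (hkeep hFm)) (hy v),
        Measure.restrict_apply (hy _ (hkeep hFm)), Set.inter_comm]
      -- Diagonal pairs are related by `keep D` even outside `D` and impose no condition. If an
      -- off-diagonal pair is not contained in `D`, the event is empty.
      let F' : Finset (ℕ × ℕ) := {p ∈ F | p.1 ≠ p.2}
      by_cases hF : ∀ p ∈ F', p.1 ∈ D ∧ p.2 ∈ D
      · have hpre : keep D ⁻¹' agree F = agree F' := by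
          ext ρ
          constructor
          · intro hρ p hp
            obtain ⟨hpF, hne⟩ := Finset.mem_filter.1 hp
            exact ((hρ p hpF).resolve_left hne).2.2
          · intro hρ p hp
            by_cases hne : p.1 = p.2
            · exact Or.inl hne
            · have hp' : p ∈ F' := Finset.mem_filter.2 ⟨hp, hne⟩
              exact Or.inr ⟨(hF p hp').1, (hF p hp').2, hρ p hp'⟩
        rw [hpre]
        exact h.split v G' hG' F' fun ω hω p hp =>
          ⟨hGD ω (hG'G hω) _ (hF p hp).1, hGD ω (hG'G hω) _ (hF p hp).2⟩
      · have hpre : keep D ⁻¹' agree F = ∅ := by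
          ext ρ
          refine ⟨fun hρ => hF fun p hp => ?_, fun h => h.elim⟩
          obtain ⟨hpF, hne⟩ := Finset.mem_filter.1 hp
          have := (hρ p hpF).resolve_left hne
          exact ⟨this.1, this.2.1⟩
        rw [hpre]
        simp
    have e := congrArg (fun ν : Measure (Setoid ℕ) => ∫⁻ ρ, f ρ ∂ν) key
    rw [lintegral_map hfm hkeep, lintegral_map hfm hkeep] at e
    simp_rw [hf _] at e
    rw [lintegral_map hfm (hy _), Measure.lintegral_bind (Kernel.aemeasurable _) hfm.aemeasurable,
      lintegral_map (hfm.lintegral_kernel) (hy v)] at e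
    exact e
  have hf1 : Measurable fun ω => f (y (v + 1) ω) := hfm.comp (hy _)
  have hf2 : Measurable fun ω => act P f (y v ω) := (measurable_act P hfm).comp (hy _)
  -- Equality of the integrals over all known subevents of `G` says that two measures agree on the
  -- information `σ`-algebra, so any `X` measurable for it can be integrated against either.
  have htrim : ((μ.restrict G).withDensity fun ω => f (y (v + 1) ω)).trim hle =
      ((μ.restrict G).withDensity fun ω => act P f (y v ω)).trim hle := by
    refine @Measure.ext _ (𝓕 v ⊔ insideChain y a v) _ _ fun G' hG' => ?_
    rw [trim_measurableSet_eq hle hG', trim_measurableSet_eq hle hG',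
      withDensity_apply _ (hle _ hG'), withDensity_apply _ (hle _ hG'),
      Measure.restrict_restrict (hle _ hG')]
    exact hset _ Set.inter_subset_right (hG'.inter hG)
  have hXm : Measurable X := hX.mono hle le_rfl
  calc ∫⁻ ω in G, X ω * f (y (v + 1) ω) ∂μ
      = ∫⁻ ω, X ω ∂((μ.restrict G).withDensity fun ω => f (y (v + 1) ω)) := by
        rw [lintegral_withDensity_eq_lintegral_mul _ hf1 hXm]
        exact lintegral_congr fun ω => mul_comm _ _
    _ = ∫⁻ ω, X ω ∂((μ.restrict G).withDensity fun ω => act P f (y v ω)) := by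
        rw [← lintegral_trim hle hX, htrim, lintegral_trim hle hX]
    _ = ∫⁻ ω in G, X ω * act P f (y v ω) ∂μ := by
        rw [lintegral_withDensity_eq_lintegral_mul _ hf2 hXm]
        exact lintegral_congr fun ω => mul_comm _ _

end IsSpineChain

end Chain

/-! ### Groups of labels with a common exit index and their independent evolution -/

section Chain

variable {Ω : Type*}

/-- The labels of `W` with exit index `k` in the configuration `c`. -/
def exitGroup (W : Finset ℕ) (c : ℕ → ℕ∞) (k : ℕ∞) : Set ℕ := {n | n ∈ W ∧ c n = k}

/-- The event that the exit indices of the labels in `W` are given by `c`. -/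
def exitEvent (a : ℕ → Ω → Set ℕ) (W : Finset ℕ) (c : ℕ → ℕ∞) : Set Ω :=
  {ω | ∀ n ∈ W, exitIndex a n ω = c n}

/-- The pairs of `F` with both exit indices equal to `k`. -/
noncomputable def exitPairs (c : ℕ → ℕ∞) (F : Finset (ℕ × ℕ)) (k : ℕ∞) : Finset (ℕ × ℕ) :=
  {p ∈ F | c p.1 = k ∧ c p.2 = k}

/-- `1` if all the pairs of `F` have equal exit indices, and `0` otherwise. -/
noncomputable def uncrossed (c : ℕ → ℕ∞) (F : Finset (ℕ × ℕ)) : ℝ≥0∞ :=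
  if ∀ p ∈ F, c p.1 = c p.2 then 1 else 0

/-- The indicator function of `agree F`. -/
noncomputable def agreeInd (F : Finset (ℕ × ℕ)) : Setoid ℕ → ℝ≥0∞ := (agree F).indicator 1

theorem measurable_agreeInd (F : Finset (ℕ × ℕ)) : Measurable (agreeInd F) :=
  measurable_one.indicator (measurableSet_agree F)

theorem agreeInd_eq_one {F : Finset (ℕ × ℕ)} {π : Setoid ℕ} (h : π ∈ agree F) :
    agreeInd F π = 1 := Set.indicator_of_mem h 1

theorem agreeInd_eq_zero {F : Finset (ℕ × ℕ)} {π : Setoid ℕ} (h : π ∉ agree F) :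
    agreeInd F π = 0 := Set.indicator_of_notMem h 1

theorem localTo_exitPairs {W : Finset ℕ} {c : ℕ → ℕ∞} {F : Finset (ℕ × ℕ)}
    (hF : ∀ p ∈ F, p.1 ∈ W ∧ p.2 ∈ W) (k : ℕ∞) :
    LocalTo (exitGroup W c k) (agreeInd (exitPairs c F k)) := by
  refine localTo_agree fun p hp => ?_
  obtain ⟨h1, h2, h3⟩ := Finset.mem_filter.1 hp
  exact ⟨⟨(hF p h1).1, h2⟩, ⟨(hF p h1).2, h3⟩⟩

/-- With the exit indices fixed, each group with finite index `g` is read off `y (g + l)`. A pair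
with both indices `⊤` is always related and contributes no factor; `M` bounds the finite indices. -/
theorem agreeInd_spinalChain {y : ℕ → Ω → Setoid ℕ} {a : ℕ → Ω → Set ℕ}
    {W : Finset ℕ} {c : ℕ → ℕ∞} {ω : Ω} (hω : ω ∈ exitEvent a W c)
    {F : Finset (ℕ × ℕ)} (hF : ∀ p ∈ F, p.1 ∈ W ∧ p.2 ∈ W) {M : ℕ}
    (hM : ∀ n ∈ W, c n ≠ ⊤ → c n < M) (l : ℕ) :
    agreeInd F (spinalChain y a l ω) =
      uncrossed c F * ∏ g ∈ Finset.range M, agreeInd (exitPairs c F g) (y (g + l) ω) := by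
  by_cases hu : ∀ p ∈ F, c p.1 = c p.2
  · rw [uncrossed, if_pos hu, one_mul]
    by_cases hZ : spinalChain y a l ω ∈ agree F
    · rw [agreeInd_eq_one hZ, Finset.prod_eq_one]
      intro g _
      refine agreeInd_eq_one fun p hp => ?_
      obtain ⟨h1, h2, h3⟩ := Finset.mem_filter.1 hp
      exact (hZ p h1).2 g ((hω _ (hF p h1).1).trans h2)
    · rw [agreeInd_eq_zero hZ]
      obtain ⟨p, hp, hpr⟩ : ∃ p ∈ F, ¬ (spinalChain y a l ω).r p.1 p.2 := by
        by_contra! h'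
        exact hZ h'
      rw [spinalChain_rel, hω _ (hF p hp).1, hω _ (hF p hp).2] at hpr
      obtain ⟨g, hg, hgr⟩ : ∃ g : ℕ, c p.1 = g ∧ ¬ (y (g + l) ω).r p.1 p.2 := by
        by_contra! h'
        exact hpr ⟨hu p hp, h'⟩
      have hgM : g < M := by
        have := hM _ (hF p hp).1 (hg ▸ ENat.natCast_ne_top g)
        rw [hg] at this
        exact Nat.cast_lt.1 this
      refine (Finset.prod_eq_zero (Finset.mem_range.2 hgM) (agreeInd_eq_zero fun h' => hgr ?_)).symm
      exact h' p (Finset.mem_filter.2 ⟨hp, hg, (hu p hp).symm.trans hg⟩)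
  · rw [uncrossed, if_neg hu, zero_mul]
    refine agreeInd_eq_zero fun h' => hu fun p hp => ?_
    have := (h' p hp).1
    rwa [hω _ (hF p hp).1, hω _ (hF p hp).2] at this

/-- Groups lie in different blocks of the spinal chain, so the kernel factorizes over them. The
labels of index `⊤` lie in a single block, and `htop` makes their factor equal to `1`. -/
theorem fragKer_spinalChain (P : Measure (Setoid ℕ)) [IsProbabilityMeasure P]
    {y : ℕ → Ω → Setoid ℕ} {a : ℕ → Ω → Set ℕ} {W : Finset ℕ} {c : ℕ → ℕ∞} {ω : Ω}
    (hω : ω ∈ exitEvent a W c)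
    {F : Finset (ℕ × ℕ)} (hF : ∀ p ∈ F, p.1 ∈ W ∧ p.2 ∈ W) {M : ℕ}
    (hM : ∀ n ∈ W, c n ≠ ⊤ → c n < M)
    (htop : ∀ p ∈ F, c p.1 = ⊤ → c p.2 = ⊤ → P {π | π.r p.1 p.2} = 1) (l : ℕ) :
    fragKer P (spinalChain y a l ω) (agree F) =
      uncrossed c F * ∏ g ∈ Finset.range M, act P (agreeInd (exitPairs c F g)) (y (g + l) ω) := by
  rw [← act_indicator P (measurableSet_agree F)]
  change act P (agreeInd F) _ = _
  by_cases hu : ∀ p ∈ F, c p.1 = c p.2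
  · rw [uncrossed, if_pos hu, one_mul]
    let Z := spinalChain y a l ω
    let S : Finset ℕ∞ := insert ⊤ ((Finset.range M).image (fun g : ℕ => (g : ℕ∞)))
    have hS : ∀ n ∈ W, c n ∈ S := by
      intro n hn
      by_cases hc : c n = ⊤
      · exact hc ▸ Finset.mem_insert_self _ _
      · lift c n to ℕ using hc with g hg
        have := hM n hn (hg ▸ ENat.natCast_ne_top g)
        rw [← hg] at this
        exact Finset.mem_insert_of_mem (Finset.mem_image_of_mem _
          (Finset.mem_range.2 (Nat.cast_lt.1 this)))
    have hprod : agreeInd F = fun ρ => ∏ k ∈ S, agreeInd (exitPairs c F k) ρ := by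
      funext ρ
      by_cases hρ : ρ ∈ agree F
      · rw [agreeInd_eq_one hρ, Finset.prod_eq_one]
        exact fun k _ => agreeInd_eq_one fun p hp => hρ p (Finset.mem_filter.1 hp).1
      · rw [agreeInd_eq_zero hρ]
        obtain ⟨p, hp, hpr⟩ : ∃ p ∈ F, ¬ ρ.r p.1 p.2 := by
          by_contra! h'
          exact hρ h'
        refine (Finset.prod_eq_zero (hS _ (hF p hp).1) (agreeInd_eq_zero fun h' => hpr ?_)).symm
        exact h' p (Finset.mem_filter.2 ⟨hp, rfl, (hu p hp).symm⟩)
    have hsep : ∀ k k' : ℕ∞, k ≠ k' → ∀ i ∈ exitGroup W c k, ∀ j ∈ exitGroup W c k',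
        ¬ Z.r i j := by
      intro k k' hne i hi j hj hij
      have := hij.1
      rw [hω i hi.1, hω j hj.1, hi.2, hj.2] at this
      exact hne this
    rw [hprod, act_prod P S (exitGroup W c) _ (fun k _ => localTo_exitPairs hF k)
      (fun k _ => measurable_agreeInd _) fun k _ k' _ hne => hsep k k' hne,
      Finset.prod_insert (by simp), Finset.prod_image (by simp)]
    have h1 : act P (agreeInd (exitPairs c F ⊤)) (spinalChain y a l ω) = 1 := by
      have e : act P (agreeInd (exitPairs c F ⊤)) (spinalChain y a l ω) =
          act P (agreeInd (exitPairs c F ⊤)) ⊤ := by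
        refine ((localTo_exitPairs hF ⊤).act P (measurable_agreeInd _)).congr fun i hi j hj => ?_
        refine ⟨fun _ => trivial, fun _ => ⟨?_, fun g hg => ?_⟩⟩
        · rw [hω i hi.1, hω j hj.1, hi.2, hj.2]
        · rw [hω i hi.1, hi.2] at hg
          exact absurd hg.symm (ENat.natCast_ne_top g)
      rw [e, agreeInd, act_indicator P (measurableSet_agree _), fragKer_top]
      have : ∀ᵐ π ∂P, ∀ p ∈ exitPairs c F ⊤, π.r p.1 p.2 := by
        refine (ae_ball_iff (exitPairs c F ⊤).countable_toSet).2 fun p hp => ?_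
        obtain ⟨h1, h2, h3⟩ := Finset.mem_filter.1 hp
        exact (prob_compl_eq_zero_iff (measurableSet_rel _ _)).2 (htop p h1 h2 h3)
      exact (prob_compl_eq_zero_iff (measurableSet_agree _)).1 this
    rw [h1, one_mul]
    refine Finset.prod_congr rfl fun g _ => ?_
    refine ((localTo_exitPairs hF g).act P (measurable_agreeInd _)).congr fun i hi j hj => ?_
    rw [spinalChain_rel, hω i hi.1, hω j hj.1, hi.2, hj.2]
    exact ⟨fun h' => h'.2 g rfl, fun h' => ⟨rfl, fun g' hg' => Nat.cast_injective hg' ▸ h'⟩⟩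
  · rw [uncrossed, if_neg hu, zero_mul]
    have : act P (agreeInd F) (spinalChain y a l ω) =
        ∫⁻ _, 0 ∂fragKer P (spinalChain y a l ω) := by
      refine lintegral_fragKer_congr P _ (measurable_agreeInd F) measurable_const fun ρ hρ => ?_
      refine agreeInd_eq_zero fun h' => hu fun p hp => ?_
      have := (hρ (h' p hp)).1
      rwa [hω _ (hF p hp).1, hω _ (hF p hp).2] at this
    simpa using this

theorem prod_Ico_eq_prod_range_of_eq_one {f : ℕ → ℝ≥0∞} {g n V : ℕ} (hV : g + n ≤ V)
    (hf : ∀ w, g + n ≤ w → f w = 1) :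
    ∏ w ∈ Finset.Ico g V, f w = ∏ l ∈ Finset.range n, f (g + l) := by
  rw [Finset.prod_Ico_eq_prod_range]
  refine (Finset.prod_subset (Finset.range_mono (by omega)) fun l _ hl => hf _ ?_).symm
  have := Finset.mem_range.not.1 hl
  omega

namespace IsSpineChain

variable [mΩ : MeasurableSpace Ω] {μ : Measure Ω} {P : Measure (Setoid ℕ)}
  [IsProbabilityMeasure P] {y : ℕ → Ω → Setoid ℕ} {a : ℕ → Ω → Set ℕ}
  {𝓕 : ℕ → MeasurableSpace Ω} (h : IsSpineChain μ P y a 𝓕)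

include h

theorem measurableSet_exitEvent {m : MeasurableSpace Ω} (ha : ∀ w, Measurable[m] (a w))
    (W : Finset ℕ) (c : ℕ → ℕ∞) : MeasurableSet[m] (exitEvent a W c) := by
  have : exitEvent a W c = ⋂ n ∈ W, {ω | exitIndex a n ω = c n} := by
    ext ω
    simp [exitEvent]
  rw [this]
  exact Finset.measurableSet_biInter W fun n _ =>
    measurableSet_exitIndex_eq (mΩ := mΩ) h ha n (c n)

theorem separated {W : Finset ℕ} {c : ℕ → ℕ∞} {ω : Ω} (hω : ω ∈ exitEvent a W c) {g g' v : ℕ}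
    (hne : g ≠ g') (hg : g ≤ v) (hg' : g' ≤ v) :
    ∀ i ∈ exitGroup W c g, ∀ j ∈ exitGroup W c g', ¬ (y v ω).r i j := fun i hi j hj =>
  h.not_rel_of_exitIndex_ne ((hω i hi.1).trans hi.2) ((hω j hj.1).trans hj.2) hne hg hg'

/-- One conditioning at step `v`: groups with `g ≤ v` lie outside `a v` in pairwise distinct blocks,
so their functions of `y (v + 1)` become products of conditional expectations, while everything else
is known. -/
theorem lintegral_exitEvent_step [IsFiniteMeasure μ] (W : Finset ℕ) (c : ℕ → ℕ∞)
    (ψ U : ℕ → ℕ → Setoid ℕ → ℝ≥0∞)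
    (hψm : ∀ g w, Measurable (ψ g w)) (hUm : ∀ g w, Measurable (U g w))
    (hUC : ∀ (g : ℕ) w, LocalTo (exitGroup W c g) (U g w)) (M v : ℕ)
    (hU : ∀ g ≤ v, ∀ π, U g v π = ψ g v π * act P (U g (v + 1)) π) :
    ∫⁻ ω in exitEvent a W c, ∏ g ∈ Finset.range M,
        (if g ≤ v + 1 then (∏ w ∈ Finset.Ico g (v + 1), ψ g w (y w ω)) * U g (v + 1) (y (v + 1) ω)
          else U g g (y g ω)) ∂μ =
      ∫⁻ ω in exitEvent a W c, ∏ g ∈ Finset.range M,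
        (if g ≤ v then (∏ w ∈ Finset.Ico g v, ψ g w (y w ω)) * U g v (y v ω)
          else U g g (y g ω)) ∂μ := by
  have ha : ∀ w, Measurable (a w) := fun w => (h.measurable_a w).mono (h.le w) le_rfl
  have hH := h.measurableSet_exitEvent ha W c
  have hHv := measurableSet_exitEvent (mΩ := mΩ) h (h.measurable_a_info v) W c
  -- Groups with `g > v` are still inside `a v`, so `keep (a v ω)` does not change their factors and
  -- makes them measurable for the inside future.
  let X : Ω → ℝ≥0∞ := fun ω => ∏ g ∈ Finset.range M,
    (if g ≤ v then (∏ w ∈ Finset.Ico g (v + 1), ψ g w (y w ω)) else U g g (keep (a v ω) (y g ω)))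
  have hX : Measurable[𝓕 v ⊔ insideChain y a v] X := by
    refine Finset.measurable_prod _ fun g _ => ?_
    by_cases hg : g ≤ v
    · simp only [if_pos hg]
      refine Finset.measurable_prod _ fun w hw => (hψm g w).comp ?_
      refine (h.measurable_y w).mono ((h.mono ?_).trans le_sup_left) le_rfl
      have := (Finset.mem_Ico.1 hw).2
      omega
    · simp only [if_neg hg]
      exact (hUm g g).comp
        ((measurable_keep_insideChain y a (not_le.1 hg).le).mono le_sup_right le_rfl)
  let f : Setoid ℕ → ℝ≥0∞ := fun π => ∏ g ∈ (Finset.range M).filter (· ≤ v), U g (v + 1) π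
  let D : Set ℕ := {n | n ∈ W ∧ c n ≤ v}
  have hf : LocalTo D f := LocalTo.prod fun g hg => (hUC g (v + 1)).mono fun n hn =>
    ⟨hn.1, hn.2 ▸ Nat.cast_le.2 (Finset.mem_filter.1 hg).2⟩
  have hfm : Measurable f := Finset.measurable_prod _ fun g _ => hUm g (v + 1)
  have hD : ∀ ω ∈ exitEvent a W c, ∀ i ∈ D, i ∉ a v ω := by
    intro ω hω i hi hia
    have := h.mem_iff_lt_exitIndex.1 hia
    rw [hω i hi.1] at this
    exact absurd hi.2 (not_le.2 this)
  have hXU : ∀ ω ∈ exitEvent a W c, ∀ g, v < g → U g g (keep (a v ω) (y g ω)) = U g g (y g ω) := by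
    intro ω hω g hg
    have hsub : exitGroup W c g ⊆ a v ω := by
      intro n hn
      refine h.mem_iff_lt_exitIndex.2 ?_
      rw [hω n hn.1, hn.2]
      exact Nat.cast_lt.2 hg
    exact (hUC g g).mono hsub (y g ω)
  have e1 : ∀ ω ∈ exitEvent a W c, ∏ g ∈ Finset.range M,
      (if g ≤ v + 1 then (∏ w ∈ Finset.Ico g (v + 1), ψ g w (y w ω)) * U g (v + 1) (y (v + 1) ω)
          else U g g (y g ω)) = X ω * f (y (v + 1) ω) := by
    intro ω hω
    simp only [X, f]
    rw [Finset.prod_filter, ← Finset.prod_mul_distrib]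
    refine Finset.prod_congr rfl fun g _ => ?_
    by_cases hg : g ≤ v
    · rw [if_pos hg, if_pos hg, if_pos (by omega)]
    · rw [if_neg hg, if_neg hg, hXU ω hω g (not_le.1 hg), mul_one]
      by_cases hg' : g ≤ v + 1
      -- A group leaving exactly at `v + 1` has an empty product of past factors, so both branches
      -- agree for it.
      · obtain rfl : g = v + 1 := by omega
        rw [if_pos le_rfl, Finset.Ico_self, Finset.prod_empty, one_mul]
      · rw [if_neg hg']
  have e2 : ∀ ω ∈ exitEvent a W c, ∏ g ∈ Finset.range M,
      (if g ≤ v then (∏ w ∈ Finset.Ico g v, ψ g w (y w ω)) * U g v (y v ω)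
          else U g g (y g ω)) = X ω * act P f (y v ω) := by
    intro ω hω
    have : act P f (y v ω) = ∏ g ∈ (Finset.range M).filter (· ≤ v), act P (U g (v + 1)) (y v ω) :=
      act_prod P _ (fun g : ℕ => exitGroup W c g) (fun g => U g (v + 1)) (fun g _ => hUC g (v + 1))
        (fun g _ => hUm g (v + 1)) fun g hg g' hg' hne =>
          h.separated hω hne (Finset.mem_filter.1 hg).2 (Finset.mem_filter.1 hg').2
    rw [this]
    simp only [X]
    rw [Finset.prod_filter, ← Finset.prod_mul_distrib]
    refine Finset.prod_congr rfl fun g _ => ?_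
    by_cases hg : g ≤ v
    · rw [if_pos hg, if_pos hg, if_pos hg, Finset.prod_Ico_succ_top hg, hU g hg, mul_assoc]
    · rw [if_neg hg, if_neg hg, if_neg hg, hXU ω hω g (not_le.1 hg), mul_one]
  rw [setLIntegral_congr_fun hH e1, setLIntegral_congr_fun hH e2]
  exact h.lintegral_mul_split hHv hD hX hf hfm

/-- The groups of labels that leave at different times evolve independently after their exit. -/
theorem lintegral_exitEvent_prod [IsFiniteMeasure μ] (W : Finset ℕ) (c : ℕ → ℕ∞)
    (ψ : ℕ → ℕ → Setoid ℕ → ℝ≥0∞) (hψm : ∀ g w, Measurable (ψ g w))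
    (hψC : ∀ (g : ℕ) w, LocalTo (exitGroup W c g) (ψ g w)) {M V : ℕ} (hMV : M ≤ V) :
    ∫⁻ ω in exitEvent a W c, ∏ g ∈ Finset.range M, ∏ w ∈ Finset.Ico g (V + 1), ψ g w (y w ω) ∂μ =
      ∫⁻ ω in exitEvent a W c, ∏ g ∈ Finset.range M, back P (ψ g) (V - g) g (y g ω) ∂μ := by
  let U : ℕ → ℕ → Setoid ℕ → ℝ≥0∞ := fun g w => back P (ψ g) (V - w) w
  have hUm : ∀ g w, Measurable (U g w) := fun g w => measurable_back P (hψm g) _ _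
  have hUC : ∀ (g : ℕ) w, LocalTo (exitGroup W c g) (U g w) := fun g w =>
    localTo_back P (hψm g) (hψC g) _ _
  -- The integrands interpolate between the backward recursions started at the exits (`v = 0`) and
  -- the full products along the chain (`v = V`).
  have key : ∀ v ≤ V, ∫⁻ ω in exitEvent a W c, ∏ g ∈ Finset.range M,
        (if g ≤ v then (∏ w ∈ Finset.Ico g v, ψ g w (y w ω)) * U g v (y v ω)
          else U g g (y g ω)) ∂μ =
      ∫⁻ ω in exitEvent a W c, ∏ g ∈ Finset.range M, U g g (y g ω) ∂μ := by
    intro v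
    induction v with
    | zero =>
      intro _
      refine lintegral_congr fun ω => Finset.prod_congr rfl fun g _ => ?_
      by_cases hg : g ≤ 0
      · obtain rfl : g = 0 := by omega
        simp
      · rw [if_neg hg]
    | succ v ih =>
      intro hv
      rw [← ih (by omega)]
      refine h.lintegral_exitEvent_step W c ψ U hψm hUm hUC M v fun g _ π => ?_
      simp only [U]
      rw [show V - v = (V - (v + 1)) + 1 by omega]
      rfl
  rw [← key V le_rfl]
  refine lintegral_congr fun ω => Finset.prod_congr rfl fun g hg => ?_
  have hgV : g ≤ V := (Finset.mem_range.1 hg).le.trans hMV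
  rw [if_pos hgV, Finset.prod_Ico_succ_top hgV]
  simp only [U, Nat.sub_self, back]

/-- Two labels that never leave the spine stay in one block forever, which is negligible when one
step separates them with positive probability. -/
theorem measure_exitEvent_eq_zero {W : Finset ℕ} {c : ℕ → ℕ∞} {i j : ℕ} (hi : i ∈ W) (hj : j ∈ W)
    (hci : c i = ⊤) (hcj : c j = ⊤) (hP : P {π | π.r i j} ≠ 1) : μ (exitEvent a W c) = 0 := by
  have hsub : exitEvent a W c ⊆ {ω | ∀ v, (y v ω).r i j} := ?_
  · exact measure_mono_null hsub ((h.dichotomy i j).resolve_left hP)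
  intro ω hω v
  have hmem : ∀ n ∈ W, c n = ⊤ → n ∈ a v ω := fun n hn hc =>
    h.mem_iff_lt_exitIndex.2 (by rw [hω n hn, hc]; exact ENat.natCast_lt_top v)
  exact (h.mem_iff_rel (hmem j hj hcj)).1 (hmem i hi hci)

theorem lintegral_exitEvent_markov [IsFiniteMeasure μ] {W : Finset ℕ} {c : ℕ → ℕ∞}
    {Φ : ℕ → Finset (ℕ × ℕ)} (hΦ : ∀ l, ∀ p ∈ Φ l, p.1 ∈ W ∧ p.2 ∈ W)
    {F : Finset (ℕ × ℕ)} (hF : ∀ p ∈ F, p.1 ∈ W ∧ p.2 ∈ W) (s : ℕ) :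
    ∫⁻ ω in exitEvent a W c, (∏ l ∈ Finset.range (s + 1), agreeInd (Φ l) (spinalChain y a l ω)) *
        agreeInd F (spinalChain y a (s + 1) ω) ∂μ =
      ∫⁻ ω in exitEvent a W c, (∏ l ∈ Finset.range (s + 1), agreeInd (Φ l) (spinalChain y a l ω)) *
        fragKer P (spinalChain y a s ω) (agree F) ∂μ := by
  by_cases htop : ∀ p ∈ F, c p.1 = ⊤ → c p.2 = ⊤ → P {π | π.r p.1 p.2} = 1
  swap
  · push Not at htop
    obtain ⟨p, hp, h1, h2, h3⟩ := htop
    rw [Measure.restrict_eq_zero.2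
      (h.measure_exitEvent_eq_zero (hF p hp).1 (hF p hp).2 h1 h2 h3)]
    simp
  obtain ⟨M, hM⟩ : ∃ M : ℕ, ∀ n ∈ W, c n ≠ ⊤ → c n < M := by
    refine ⟨W.sup (fun n => (c n).toNat) + 1, fun n hn hc => ?_⟩
    have := Finset.le_sup (f := fun n => (c n).toNat) hn
    rw [← ENat.natCast_toNat hc]
    exact Nat.cast_lt.2 (Nat.lt_succ_of_le this)
  have ha : ∀ w, Measurable (a w) := fun w => (h.measurable_a w).mono (h.le w) le_rfl
  have hy : ∀ w, Measurable (y w) := fun w => (h.measurable_y w).mono (h.le w) le_rfl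
  have hH := h.measurableSet_exitEvent ha W c
  let I : ℕ → ℕ → Setoid ℕ → ℝ≥0∞ := fun g l => agreeInd (exitPairs c (Φ l) g)
  let J : ℕ → Setoid ℕ → ℝ≥0∞ := fun g => agreeInd (exitPairs c F g)
  have hIm : ∀ g l, Measurable (I g l) := fun g l => measurable_agreeInd _
  have hJm : ∀ g, Measurable (J g) := fun g => measurable_agreeInd _
  have hIC : ∀ (g : ℕ) l, LocalTo (exitGroup W c g) (I g l) := fun g l =>
    localTo_exitPairs (hΦ l) g
  have hJC : ∀ (g : ℕ), LocalTo (exitGroup W c g) (J g) := fun g => localTo_exitPairs hF g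
  -- Group `g` runs on its own clock `w - g`. In `ψ` the test on `F` is the factor at clock `s + 1`;
  -- in `ψ'` it is replaced by its conditional expectation at clock `s`.
  let ψ : ℕ → ℕ → Setoid ℕ → ℝ≥0∞ := fun g w =>
    if w ≤ g + s then I g (w - g) else if w = g + s + 1 then J g else fun _ => 1
  let ψ' : ℕ → ℕ → Setoid ℕ → ℝ≥0∞ := fun g w =>
    if w < g + s then I g (w - g) else if w = g + s then fun π => I g s π * act P (J g) π
      else fun _ => 1
  have hψm : ∀ g w, Measurable (ψ g w) := by
    intro g w
    simp only [ψ]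
    split_ifs
    exacts [hIm _ _, hJm _, measurable_const]
  have hψm' : ∀ g w, Measurable (ψ' g w) := by
    intro g w
    simp only [ψ']
    split_ifs
    exacts [hIm _ _, (hIm _ _).mul (measurable_act P (hJm _)), measurable_const]
  have hψC : ∀ (g : ℕ) w, LocalTo (exitGroup W c g) (ψ g w) := by
    intro g w
    simp only [ψ]
    split_ifs
    exacts [hIC _ _, hJC _, localTo_const _ _]
  have hψC' : ∀ (g : ℕ) w, LocalTo (exitGroup W c g) (ψ' g w) := by
    intro g w
    simp only [ψ']
    split_ifs
    exacts [hIC _ _, (hIC _ _).mul ((hJC _).act P (hJm _)), localTo_const _ _]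
  let δ : ℝ≥0∞ := (∏ l ∈ Finset.range (s + 1), uncrossed c (Φ l)) * uncrossed c F
  -- A common horizon beyond clock `s + 1` of every group `g < M`; the remaining factors are `1`.
  let V : ℕ := M + s + 1
  have e1 : ∀ ω ∈ exitEvent a W c,
      (∏ l ∈ Finset.range (s + 1), agreeInd (Φ l) (spinalChain y a l ω)) *
        agreeInd F (spinalChain y a (s + 1) ω) =
      δ * ∏ g ∈ Finset.range M, ∏ w ∈ Finset.Ico g (V + 1), ψ g w (y w ω) := by
    intro ω hω
    have hg : ∀ g ∈ Finset.range M, ∏ w ∈ Finset.Ico g (V + 1), ψ g w (y w ω) =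
        (∏ l ∈ Finset.range (s + 1), I g l (y (g + l) ω)) * J g (y (g + (s + 1)) ω) := by
      intro g hg
      have hgM := Finset.mem_range.1 hg
      rw [prod_Ico_eq_prod_range_of_eq_one (n := s + 2) (by simp only [V]; omega),
        Finset.prod_range_succ]
      · congr 1
        · refine Finset.prod_congr rfl fun l hl => ?_
          have := Finset.mem_range.1 hl
          simp only [ψ]
          rw [if_pos (by omega), Nat.add_sub_cancel_left]
        · simp only [ψ]
          rw [if_neg (by omega), if_pos (by omega)]
      · intro w hw
        simp only [ψ]
        rw [if_neg (by omega), if_neg (by omega)]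
    rw [Finset.prod_congr rfl hg, Finset.prod_mul_distrib, Finset.prod_comm,
      agreeInd_spinalChain hω hF hM,
      Finset.prod_congr rfl fun l _ => agreeInd_spinalChain hω (hΦ l) hM l,
      Finset.prod_mul_distrib]
    simp only [δ, I, J]
    ring
  have e2 : ∀ ω ∈ exitEvent a W c,
      (∏ l ∈ Finset.range (s + 1), agreeInd (Φ l) (spinalChain y a l ω)) *
        fragKer P (spinalChain y a s ω) (agree F) =
      δ * ∏ g ∈ Finset.range M, ∏ w ∈ Finset.Ico g (V + 1), ψ' g w (y w ω) := by
    intro ω hω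
    have hg : ∀ g ∈ Finset.range M, ∏ w ∈ Finset.Ico g (V + 1), ψ' g w (y w ω) =
        (∏ l ∈ Finset.range (s + 1), I g l (y (g + l) ω)) * act P (J g) (y (g + s) ω) := by
      intro g hg
      have hgM := Finset.mem_range.1 hg
      rw [prod_Ico_eq_prod_range_of_eq_one (n := s + 1) (by simp only [V]; omega),
        Finset.prod_range_succ, Finset.prod_range_succ, mul_assoc]
      · congr 1
        · refine Finset.prod_congr rfl fun l hl => ?_
          have := Finset.mem_range.1 hl
          simp only [ψ']
          rw [if_pos (by omega), Nat.add_sub_cancel_left]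
        · simp only [ψ']
          rw [if_neg (by omega), if_true]
      · intro w hw
        simp only [ψ']
        rw [if_neg (by omega), if_neg (by omega)]
    rw [Finset.prod_congr rfl hg, Finset.prod_mul_distrib, Finset.prod_comm,
      fragKer_spinalChain P hω hF hM htop,
      Finset.prod_congr rfl fun l _ => agreeInd_spinalChain hω (hΦ l) hM l,
      Finset.prod_mul_distrib]
    simp only [δ, I, J]
    ring
  have hmeas : ∀ χ : ℕ → ℕ → Setoid ℕ → ℝ≥0∞, (∀ g w, Measurable (χ g w)) → Measurable fun ω =>
      ∏ g ∈ Finset.range M, ∏ w ∈ Finset.Ico g (V + 1), χ g w (y w ω) := fun χ hχ =>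
    Finset.measurable_prod _ fun g _ => Finset.measurable_prod _ fun w _ => (hχ g w).comp (hy w)
  rw [setLIntegral_congr_fun hH e1, setLIntegral_congr_fun hH e2,
    lintegral_const_mul _ (hmeas ψ hψm), lintegral_const_mul _ (hmeas ψ' hψm'),
    h.lintegral_exitEvent_prod W c ψ hψm hψC (by simp only [V]; omega),
    h.lintegral_exitEvent_prod W c ψ' hψm' hψC' (by simp only [V]; omega)]
  congr 1
  refine lintegral_congr fun ω => Finset.prod_congr rfl fun g hg => ?_
  have hgM := Finset.mem_range.1 hg
  refine congrFun (back_congr_step P (m := g + s) (fun w hw => ?_) ?_ (fun w hw => ?_)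
    (fun w hw => ?_) _ _ (by omega) (by simp only [V]; omega)) _
  · simp only [ψ, ψ']
    rw [if_pos hw.le, if_pos hw]
  · simp only [ψ, ψ']
    rw [if_neg (lt_irrefl _), if_true, if_pos le_rfl, if_neg (by omega), if_true,
      Nat.add_sub_cancel_left]
  · simp only [ψ]
    rw [if_neg (by omega), if_neg (by omega)]
  · simp only [ψ']
    rw [if_neg (by omega), if_neg (by omega)]

end IsSpineChain

end Chain

theorem fragKer_dirac_top : fragKer (Measure.dirac ⊤) = Kernel.id := by
  ext1 π
  rw [fragKer_apply, Measure.infinitePi_dirac, Measure.map_dirac' (measurable_fragment π),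
    Kernel.id_apply]
  congr 1
  exact setoid_ext fun i j => and_iff_left trivial

/-! ### Markov property of the spinal chain given the exit indices -/

section Chain

variable {Ω : Type*}

namespace IsSpineChain

variable [mΩ : MeasurableSpace Ω] {μ : Measure Ω} {P : Measure (Setoid ℕ)}
  [IsProbabilityMeasure P] {y : ℕ → Ω → Setoid ℕ} {a : ℕ → Ω → Set ℕ}
  {𝓕 : ℕ → MeasurableSpace Ω} (h : IsSpineChain μ P y a 𝓕)

include h

theorem measurable_spinalChain (l : ℕ) : Measurable (spinalChain y a l) := by
  have ha : ∀ w, Measurable (a w) := fun w => (h.measurable_a w).mono (h.le w) le_rfl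
  have hy : ∀ w, Measurable (y w) := fun w => (h.measurable_y w).mono (h.le w) le_rfl
  refine measurable_of_rel fun i j => ?_
  have : {ω | (spinalChain y a l ω).r i j} =
      (⋃ k, ({ω | exitIndex a i ω = k} ∩ {ω | exitIndex a j ω = k})) ∩
        ⋂ g : ℕ, ({ω | exitIndex a i ω = g}ᶜ ∪ {ω | (y (g + l) ω).r i j}) := by
    ext ω
    simp [spinalChain_rel, imp_iff_not_or, eq_comm]
  rw [this]
  have hk := h.measurableSet_exitIndex_eq ha
  exact (MeasurableSet.iUnion fun k => (hk i k).inter (hk j k)).inter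
    (MeasurableSet.iInter fun g => (hk i g).compl.union (hy _ (measurableSet_rel i j)))

/-- Finitely many labels have countably many exit configurations, which partition the space. The
value `⊤` outside `W` is a filler that `exitEvent` does not read. -/
theorem lintegral_eq_tsum_exitEvent (W : Finset ℕ) (u : Ω → ℝ≥0∞) :
    ∫⁻ ω, u ω ∂μ = ∑' c : W → ℕ∞, ∫⁻ ω in
      exitEvent a W (fun n => if hn : n ∈ W then c ⟨n, hn⟩ else ⊤), u ω ∂μ := by
  have ha : ∀ w, Measurable (a w) := fun w => (h.measurable_a w).mono (h.le w) le_rfl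
  have hmem : ∀ (c : W → ℕ∞) ω,
      ω ∈ exitEvent a W (fun n => if hn : n ∈ W then c ⟨n, hn⟩ else ⊤) ↔
        ∀ n : W, exitIndex a n ω = c n := by
    intro c ω
    constructor
    · intro hω n
      exact (hω n n.2).trans (dif_pos n.2)
    · intro hω n hn
      refine (hω ⟨n, hn⟩).trans ?_
      change _ = dite _ _ _
      rw [dif_pos hn]
  rw [← lintegral_iUnion (fun c => h.measurableSet_exitEvent ha W _)]
  · rw [show (⋃ c : W → ℕ∞, exitEvent a W (fun n => if hn : n ∈ W then c ⟨n, hn⟩ else ⊤)) =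
      Set.univ from Set.eq_univ_of_forall fun ω =>
        Set.mem_iUnion.2 ⟨fun n => exitIndex a n ω, (hmem _ _).2 fun n => rfl⟩,
      Measure.restrict_univ]
  · intro c c' hne
    refine Set.disjoint_left.2 fun ω hω hω' => hne (funext fun n => ?_)
    rw [← (hmem c ω).1 hω n, (hmem c' ω).1 hω' n]

/-- One-step Markov property of the spinal chain, given the exit indices and its past. -/
theorem map_spinalChain_succ [IsFiniteMeasure μ] {W : Finset ℕ} {Φ : ℕ → Finset (ℕ × ℕ)}
    (hΦ : ∀ l, ∀ p ∈ Φ l, p.1 ∈ W ∧ p.2 ∈ W) (Q : Finset (ℕ × ℕ)) (s : ℕ) {G : Set Ω}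
    (hG : G = {ω | (∀ q ∈ Q, q.1 ∈ a q.2 ω) ∧ ∀ l ≤ s, spinalChain y a l ω ∈ agree (Φ l)}) :
    (μ.restrict G).map (spinalChain y a (s + 1)) =
      ((μ.restrict G).map (spinalChain y a s)).bind (fragKer P) := by
  have ha : ∀ w, Measurable (a w) := fun w => (h.measurable_a w).mono (h.le w) le_rfl
  have hZ := h.measurable_spinalChain
  let EQ : Set Ω := {ω | ∀ q ∈ Q, q.1 ∈ a q.2 ω}
  have hEQ : MeasurableSet EQ := by
    have : EQ = ⋂ q ∈ Q, {ω | q.1 ∈ a q.2 ω} := by ext; simp [EQ]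
    rw [this]
    exact Finset.measurableSet_biInter _ fun q _ =>
      measurableSet_setOfPred.2 (measurable_set_iff.1 (ha q.2) q.1)
  have hGm : MeasurableSet G := by
    have : G = EQ ∩ ⋂ l ∈ Finset.range (s + 1), spinalChain y a l ⁻¹' agree (Φ l) := by
      rw [hG]
      ext ω
      simp only [EQ, Set.mem_ofPred_eq, Set.mem_inter_iff, Set.mem_iInter, Finset.mem_range,
        Nat.lt_succ_iff, Set.mem_preimage]
    rw [this]
    exact hEQ.inter (Finset.measurableSet_biInter _ fun l _ => hZ l (measurableSet_agree _))
  have hGi : ∀ ω, G.indicator (1 : Ω → ℝ≥0∞) ω = EQ.indicator 1 ω *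
      ∏ l ∈ Finset.range (s + 1), agreeInd (Φ l) (spinalChain y a l ω) := by
    intro ω
    by_cases hωQ : ω ∈ EQ
    · rw [Set.indicator_of_mem hωQ, Pi.one_apply, one_mul]
      by_cases hω : ∀ l ≤ s, spinalChain y a l ω ∈ agree (Φ l)
      · rw [Set.indicator_of_mem (hG ▸ ⟨hωQ, hω⟩), Finset.prod_eq_one]
        · rfl
        · exact fun l hl => agreeInd_eq_one (hω l (Nat.lt_succ_iff.1 (Finset.mem_range.1 hl)))
      · rw [Set.indicator_of_notMem]
        · push Not at hω
          obtain ⟨l, hl, hlω⟩ := hω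
          exact (Finset.prod_eq_zero (Finset.mem_range.2 (Nat.lt_succ_of_le hl))
            (agreeInd_eq_zero hlω)).symm
        · rw [hG]
          exact fun h' => hω h'.2
    · rw [Set.indicator_of_notMem hωQ, zero_mul, Set.indicator_of_notMem]
      rw [hG]
      exact fun h' => hωQ h'.1
  refine ext_agree fun F => ?_
  have hFm := measurableSet_agree F
  have e1 : (μ.restrict G).map (spinalChain y a (s + 1)) (agree F) =
      ∫⁻ ω, EQ.indicator 1 ω * ((∏ l ∈ Finset.range (s + 1), agreeInd (Φ l) (spinalChain y a l ω)) *
        agreeInd F (spinalChain y a (s + 1) ω)) ∂μ := by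
    rw [Measure.map_apply (hZ _) hFm, ← lintegral_indicator_one (hZ _ hFm),
      ← lintegral_indicator hGm]
    refine lintegral_congr fun ω => ?_
    rw [← mul_assoc, ← hGi]
    by_cases hω : ω ∈ G
    · rw [Set.indicator_of_mem hω, Set.indicator_of_mem hω, Pi.one_apply, one_mul]
      rfl
    · rw [Set.indicator_of_notMem hω, Set.indicator_of_notMem hω, zero_mul]
  have e2 : ((μ.restrict G).map (spinalChain y a s)).bind (fragKer P) (agree F) =
      ∫⁻ ω, EQ.indicator 1 ω * ((∏ l ∈ Finset.range (s + 1), agreeInd (Φ l) (spinalChain y a l ω)) *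
        fragKer P (spinalChain y a s ω) (agree F)) ∂μ := by
    rw [Measure.bind_apply hFm (Kernel.aemeasurable _),
      lintegral_map ((fragKer P).measurable_coe hFm) (hZ s), ← lintegral_indicator hGm]
    refine lintegral_congr fun ω => ?_
    rw [← mul_assoc, ← hGi]
    by_cases hω : ω ∈ G
    · rw [Set.indicator_of_mem hω, Set.indicator_of_mem hω, Pi.one_apply, one_mul]
    · rw [Set.indicator_of_notMem hω, Set.indicator_of_notMem hω, zero_mul]
  rw [e1, e2]
  classical
  -- With the labels of `Q` included, the spine event `EQ` is decided by the exit configuration and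
  -- leaves each integral as a constant.
  let W' : Finset ℕ := W ∪ Q.image Prod.fst ∪ F.image Prod.fst ∪ F.image Prod.snd
  have hΦ' : ∀ l, ∀ p ∈ Φ l, p.1 ∈ W' ∧ p.2 ∈ W' := by
    intro l p hp
    have := hΦ l p hp
    simp only [W', Finset.mem_union]
    tauto
  have hF' : ∀ p ∈ F, p.1 ∈ W' ∧ p.2 ∈ W' := by
    intro p hp
    have h1 := Finset.mem_image_of_mem Prod.fst hp
    have h2 := Finset.mem_image_of_mem Prod.snd hp
    simp only [W', Finset.mem_union]
    tauto
  have hQ' : ∀ q ∈ Q, q.1 ∈ W' := by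
    intro q hq
    have h1 := Finset.mem_image_of_mem Prod.fst hq
    simp only [W', Finset.mem_union]
    tauto
  rw [h.lintegral_eq_tsum_exitEvent W', h.lintegral_eq_tsum_exitEvent W']
  congr 1
  funext c₀
  generalize (fun n => if hn : n ∈ W' then c₀ ⟨n, hn⟩ else ⊤) = c
  have hH := h.measurableSet_exitEvent ha W' c
  have hEQc : ∀ ω ∈ exitEvent a W' c, EQ.indicator (1 : Ω → ℝ≥0∞) ω =
      if ∀ q ∈ Q, (q.2 : ℕ∞) < c q.1 then 1 else 0 := by
    intro ω hω
    have : ω ∈ EQ ↔ ∀ q ∈ Q, (q.2 : ℕ∞) < c q.1 := by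
      refine forall₂_congr fun q hq => ?_
      rw [h.mem_iff_lt_exitIndex, hω _ (hQ' q hq)]
    by_cases hωQ : ω ∈ EQ
    · rw [Set.indicator_of_mem hωQ, if_pos (this.1 hωQ), Pi.one_apply]
    · rw [Set.indicator_of_notMem hωQ, if_neg (mt this.2 hωQ)]
  have hprod : Measurable fun ω =>
      ∏ l ∈ Finset.range (s + 1), agreeInd (Φ l) (spinalChain y a l ω) :=
    Finset.measurable_prod _ fun l _ => (measurable_agreeInd _).comp (hZ l)
  have hm1 : Measurable fun ω => (∏ l ∈ Finset.range (s + 1), agreeInd (Φ l) (spinalChain y a l ω)) *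
      agreeInd F (spinalChain y a (s + 1) ω) := hprod.mul ((measurable_agreeInd _).comp (hZ _))
  have hm2 : Measurable fun ω => (∏ l ∈ Finset.range (s + 1), agreeInd (Φ l) (spinalChain y a l ω)) *
      fragKer P (spinalChain y a s ω) (agree F) :=
    hprod.mul (((fragKer P).measurable_coe hFm).comp (hZ _))
  have hpull : ∀ u : Ω → ℝ≥0∞, Measurable u →
      ∫⁻ ω in exitEvent a W' c, EQ.indicator 1 ω * u ω ∂μ =
        (if ∀ q ∈ Q, (q.2 : ℕ∞) < c q.1 then 1 else 0) * ∫⁻ ω in exitEvent a W' c, u ω ∂μ := by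
    intro u hu
    rw [← lintegral_const_mul _ hu]
    exact setLIntegral_congr_fun hH fun ω hω => congrArg (· * u ω) (hEQc ω hω)
  rw [hpull _ hm1, hpull _ hm2, h.lintegral_exitEvent_markov hΦ' hF' s]

/-- Markov property of the spinal chain over several steps. -/
theorem map_spinalChain_add [IsFiniteMeasure μ] {W : Finset ℕ} {Φ : ℕ → Finset (ℕ × ℕ)}
    (hΦ : ∀ l, ∀ p ∈ Φ l, p.1 ∈ W ∧ p.2 ∈ W) (Q : Finset (ℕ × ℕ)) (s : ℕ) {G : Set Ω}
    (hG : G = {ω | (∀ q ∈ Q, q.1 ∈ a q.2 ω) ∧ ∀ l ≤ s, spinalChain y a l ω ∈ agree (Φ l)})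
    {R : ℕ → Measure (Setoid ℕ)} [∀ m, IsProbabilityMeasure (R m)]
    (hR0 : R 0 = Measure.dirac ⊤) (hR : ∀ m, R (m + 1) = (R m).bind (fragKer P)) (m : ℕ) :
    (μ.restrict G).map (spinalChain y a (s + m)) =
      ((μ.restrict G).map (spinalChain y a s)).bind (fragKer (R m)) := by
  induction m with
  | zero =>
    have : fragKer (R 0) = Kernel.id := by
      rw [← fragKer_dirac_top]
      congr
    rw [this, Measure.id_comp, add_zero]
  | succ m ih =>
    -- Empty constraints after `s` exhibit the same `G` as an event of the past up to `s + m`.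
    have hstep := h.map_spinalChain_succ (W := W) (Φ := fun l => if l ≤ s then Φ l else ∅)
      (fun l p hp => by
        by_cases hl : l ≤ s
        · exact hΦ l p (by simpa [hl] using hp)
        · simp [hl] at hp) Q (s + m) (G := G) (by
        rw [hG]
        ext ω
        refine and_congr Iff.rfl ⟨fun h' l _ => ?_, fun h' l hl => ?_⟩
        · by_cases hls : l ≤ s
          · simpa [hls] using h' l hls
          · simp [hls, agree]
        · simpa [hl] using h' l (by omega))
    rw [← add_assoc, hstep, ih, Measure.bind_bind (Kernel.aemeasurable _) (Kernel.aemeasurable _)]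
    congr 1
    funext π
    exact (fragKer_comp (hR m) π).symm

end IsSpineChain

end Chain

/-! ### Measures on generated `σ`-algebras and conditional independence -/

section MeasureTheory

theorem measurableSet_mem_of_measurable {α β : Type*} {m : MeasurableSpace α} {g : α → Set β}
    (hg : Measurable g) (b : β) : MeasurableSet {x | b ∈ g x} :=
  measurableSet_setOfPred.2 (measurable_set_iff.1 hg b)

variable {Ω : Type*} {m m₁ m₂ mΩ : MeasurableSpace Ω}

/-- Two finite measures that agree on a `π`-system agree on the `σ`-algebra it generates. -/
theorem measure_eq_of_generateFrom {ν ν' : Measure Ω} [IsFiniteMeasure ν] {C : Set (Set Ω)}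
    (hC : IsPiSystem C) (hCm : ∀ s ∈ C, MeasurableSet s) (huniv : Set.univ ∈ C)
    (h : ∀ s ∈ C, ν s = ν' s) {G : Set Ω} (hG : MeasurableSet[MeasurableSpace.generateFrom C] G) :
    ν G = ν' G := by
  have hle : MeasurableSpace.generateFrom C ≤ mΩ := MeasurableSpace.generateFrom_le hCm
  have hm : ∀ s ∈ C, MeasurableSet[MeasurableSpace.generateFrom C] s := fun s hs =>
    MeasurableSpace.measurableSet_generateFrom hs
  have : ν.trim hle = ν'.trim hle := by
    refine @ext_of_generate_finite _ (MeasurableSpace.generateFrom C) _ _ C rfl hC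
      (isFiniteMeasure_trim hle) (fun s hs => ?_) ?_
    · rw [trim_measurableSet_eq hle (hm s hs), trim_measurableSet_eq hle (hm s hs), h s hs]
    · rw [trim_measurableSet_eq hle (hm _ huniv), trim_measurableSet_eq hle (hm _ huniv),
        h _ huniv]
  rw [← trim_measurableSet_eq hle hG, this, trim_measurableSet_eq hle hG]

theorem measure_eq_of_sup {ν ν' : Measure Ω} [IsFiniteMeasure ν]
    (h₁ : m₁ ≤ mΩ) (h₂ : m₂ ≤ mΩ)
    (h : ∀ B S, MeasurableSet[m₁] B → MeasurableSet[m₂] S → ν (B ∩ S) = ν' (B ∩ S)) {G : Set Ω}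
    (hG : MeasurableSet[m₁ ⊔ m₂] G) : ν G = ν' G := by
  let C : Set (Set Ω) := {G | ∃ B S, MeasurableSet[m₁] B ∧ MeasurableSet[m₂] S ∧ G = B ∩ S}
  have hle : m₁ ⊔ m₂ ≤ MeasurableSpace.generateFrom C := by
    refine sup_le (fun B hB => ?_) (fun S hS => ?_)
    · exact MeasurableSpace.measurableSet_generateFrom
        ⟨B, Set.univ, hB, @MeasurableSet.univ _ m₂, (Set.inter_univ B).symm⟩
    · exact MeasurableSpace.measurableSet_generateFrom
        ⟨Set.univ, S, @MeasurableSet.univ _ m₁, hS, (Set.univ_inter S).symm⟩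
  refine measure_eq_of_generateFrom (mΩ := mΩ) (ν := ν) (C := C) ?_ ?_ ?_ ?_ (hle _ hG)
  · rintro _ ⟨B, S, hB, hS, rfl⟩ _ ⟨B', S', hB', hS', rfl⟩ _
    exact ⟨B ∩ B', S ∩ S', hB.inter hB', hS.inter hS', Set.inter_inter_inter_comm B S B' S'⟩
  · rintro _ ⟨B, S, hB, hS, rfl⟩
    exact (h₁ _ hB).inter (h₂ _ hS)
  · exact ⟨Set.univ, Set.univ, @MeasurableSet.univ _ m₁, @MeasurableSet.univ _ m₂,
      (Set.inter_univ _).symm⟩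
  · rintro _ ⟨B, S, hB, hS, rfl⟩
    exact h B S hB hS

variable {μ : Measure Ω} [IsProbabilityMeasure μ]

theorem ofReal_setIntegral_toReal {K : Ω → ℝ≥0∞} (hK : Measurable K) (hK1 : ∀ ω, K ω ≤ 1)
    (B : Set Ω) : ENNReal.ofReal (∫ ω in B, (K ω).toReal ∂μ) = ∫⁻ ω in B, K ω ∂μ := by
  have hintg : IntegrableOn (fun ω => (K ω).toReal) B μ :=
    Integrable.of_bound hK.ennreal_toReal.aestronglyMeasurable 1 (Eventually.of_forall fun ω => by
      rw [Real.norm_of_nonneg ENNReal.toReal_nonneg]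
      exact ENNReal.toReal_le_of_le_ofReal zero_le_one (by simpa using hK1 ω))
  rw [ofReal_integral_eq_lintegral_ofReal hintg (Eventually.of_forall fun _ => ENNReal.toReal_nonneg)]
  exact lintegral_congr fun ω => ENNReal.ofReal_toReal (ne_top_of_le_ne_top ENNReal.one_ne_top (hK1 ω))

/-- Conditional independence in integral form. -/
theorem measure_inter_of_condIndep (hm : m ≤ mΩ) {S T B : Set Ω}
    (hS : MeasurableSet S) (hT : MeasurableSet T) (hB : MeasurableSet[m] B)
    {K : Ω → ℝ≥0∞} (hK : Measurable[m] K) (hK1 : ∀ ω, K ω ≤ 1)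
    (hTK : μ⟦T | m⟧ =ᵐ[μ] fun ω => (K ω).toReal)
    (hST : μ⟦S ∩ T | m⟧ =ᵐ[μ] μ⟦S | m⟧ * μ⟦T | m⟧) :
    μ (B ∩ S ∩ T) = ∫⁻ ω in B ∩ S, K ω ∂μ := by
  have hintg : ∀ {D : Set Ω}, MeasurableSet D → Integrable (D.indicator fun _ => (1 : ℝ)) μ :=
    fun hD => (integrable_const 1).indicator hD
  have hk : StronglyMeasurable[m] fun ω => (K ω).toReal :=
    (@Measurable.ennreal_toReal _ m _ hK).stronglyMeasurable
  have hkint : Integrable (fun ω => (K ω).toReal) μ :=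
    Integrable.of_bound (hk.mono hm).aestronglyMeasurable 1 (Eventually.of_forall fun ω => by
      rw [Real.norm_of_nonneg ENNReal.toReal_nonneg]
      exact ENNReal.toReal_le_of_le_ofReal zero_le_one (by simpa using hK1 ω))
  have hprod : (S.indicator fun _ => (1 : ℝ)) * (fun ω => (K ω).toReal) =
      S.indicator fun ω => (K ω).toReal := by
    funext ω
    by_cases hω : ω ∈ S <;> simp [hω]
  have hpull : μ[S.indicator (fun ω => (K ω).toReal) | m] =ᵐ[μ]
      μ⟦S | m⟧ * fun ω => (K ω).toReal := by
    rw [← hprod]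
    exact condExp_mul_of_stronglyMeasurable_right hk (hprod ▸ hkint.indicator hS) (hintg hS)
  have e : μ.real (B ∩ S ∩ T) = ∫ ω in B ∩ S, (K ω).toReal ∂μ := by
    calc μ.real (B ∩ S ∩ T) = ∫ ω in B, (S ∩ T).indicator (fun _ => (1 : ℝ)) ω ∂μ := by
          rw [integral_indicator (hS.inter hT), setIntegral_const, smul_eq_mul, mul_one,
            measureReal_restrict_apply (hS.inter hT), Set.inter_comm (S ∩ T), Set.inter_assoc]
      _ = ∫ ω in B, (μ⟦S ∩ T | m⟧) ω ∂μ := (setIntegral_condExp hm (hintg (hS.inter hT)) hB).symm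
      _ = ∫ ω in B, (μ[S.indicator (fun ω => (K ω).toReal) | m]) ω ∂μ := by
          refine setIntegral_congr_ae (hm _ hB) ?_
          filter_upwards [hTK, hST, hpull] with ω h1 h2 h3 _
          rw [h2, h3, Pi.mul_apply, Pi.mul_apply, h1]
      _ = ∫ ω in B, S.indicator (fun ω => (K ω).toReal) ω ∂μ :=
          setIntegral_condExp hm (hkint.indicator hS) hB
      _ = ∫ ω in B ∩ S, (K ω).toReal ∂μ := by
          rw [integral_indicator hS, Measure.restrict_restrict hS, Set.inter_comm]
  rw [← ofReal_setIntegral_toReal (hK.mono hm le_rfl) hK1, ← e, ofReal_measureReal]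

end MeasureTheory

/-! ### Homogeneous fragmentations and their Markovian paths on a grid -/

section Fragmentation

variable {Ω : Type*} [mΩ : MeasurableSpace Ω] {Y : ℝ≥0 → Ω → Setoid ℕ}

theorem IsHomogeneousFragmentation.past_le {μ : Measure Ω} (hY : IsHomogeneousFragmentation μ Y) 
    (s : ℝ≥0) : past Y s ≤ mΩ :=
  iSup₂_le fun u _ => (hY.branching.measurable u).comap_le

variable {μ : Measure Ω} [IsProbabilityMeasure μ] (hY : IsHomogeneousFragmentation μ Y)

theorem IsHomogeneousFragmentation.isProbabilityMeasure_map
    (hY : IsHomogeneousFragmentation μ Y) (t : ℝ≥0) : IsProbabilityMeasure (μ.map (Y t)) :=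
  Measure.isProbabilityMeasure_map (hY.branching.measurable t).aemeasurable

/-- The kernel of a homogeneous fragmentation process over a time `t`. -/
noncomputable def IsHomogeneousFragmentation.kernel (hY : IsHomogeneousFragmentation μ Y)
    (t : ℝ≥0) : Kernel (Setoid ℕ) (Setoid ℕ) :=
  haveI := hY.isProbabilityMeasure_map t
  fragKer (μ.map (Y t))

theorem IsHomogeneousFragmentation.kernel_eq (hY : IsHomogeneousFragmentation μ Y) (t : ℝ≥0)
    [IsProbabilityMeasure (μ.map (Y t))] : hY.kernel t = fragKer (μ.map (Y t)) := rfl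

instance IsHomogeneousFragmentation.isMarkovKernel_kernel (hY : IsHomogeneousFragmentation μ Y)
    (t : ℝ≥0) : IsMarkovKernel (hY.kernel t) := by
  have := hY.isProbabilityMeasure_map t
  rw [hY.kernel_eq]
  infer_instance

include hY

/-- Tower property: the kernel expression is already a function of `Y s`. This identifies the
conditional law appearing in the Markov condition of the path's filtration. -/
theorem IsHomogeneousFragmentation.markov_comap (s t : ℝ≥0) {S : Set (Setoid ℕ)}
    (hS : MeasurableSet S) :
    μ⟦Y (s + t) ⁻¹' S | MeasurableSpace.comap (Y s) inferInstance⟧ =ᵐ[μ]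
      fun ω => (hY.kernel t (Y s ω) S).toReal := by
  have hle : MeasurableSpace.comap (Y s) inferInstance ≤ ⊥ ⊔ past Y s :=
    le_sup_of_le_right (le_iSup₂_of_le s le_rfl le_rfl)
  have hle' : ⊥ ⊔ past Y s ≤ mΩ := sup_le bot_le (hY.past_le s)
  have h1 := hY.branching.markov s t S hS
  have h2 := condExp_condExp_of_le (μ := μ)
    (f := (Y (s + t) ⁻¹' S).indicator fun _ => (1 : ℝ)) hle hle'
  refine h2.symm.trans ((condExp_congr_ae h1).trans ?_)
  have hmeas : Measurable[MeasurableSpace.comap (Y s) inferInstance]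
      fun ω => (hY.kernel t (Y s ω) S).toReal :=
    (((hY.kernel t).measurable_coe hS).ennreal_toReal).comp (comap_measurable (Y s))
  refine Eventually.of_forall fun ω => ?_
  refine congrFun (condExp_of_stronglyMeasurable (hle.trans hle') hmeas.stronglyMeasurable ?_) ω
  refine Integrable.of_bound
    (hmeas.mono (hle.trans hle') le_rfl).aestronglyMeasurable 1 (Eventually.of_forall fun ω => ?_)
  rw [Real.norm_of_nonneg ENNReal.toReal_nonneg]
  exact ENNReal.toReal_le_of_le_ofReal zero_le_one (by simpa using prob_le_one)

theorem IsHomogeneousFragmentation.map_add (s t : ℝ≥0) :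
    μ.map (Y (s + t)) = (μ.map (Y s)).bind (hY.kernel t) := by
  ext S hS
  have hm := hY.branching.measurable
  rw [Measure.map_apply (hm _) hS, Measure.bind_apply hS (Kernel.aemeasurable _),
    lintegral_map ((hY.kernel t).measurable_coe hS) (hm s)]
  have hTK := hY.markov_comap s t hS
  have hle : MeasurableSpace.comap (Y s) inferInstance ≤ mΩ := (hm s).comap_le
  have := measure_inter_of_condIndep (μ := μ) hle (S := Set.univ) (T := Y (s + t) ⁻¹' S)
    (B := Set.univ) (K := fun ω => hY.kernel t (Y s ω) S) MeasurableSet.univ (hm _ hS)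
    (@MeasurableSet.univ _ _) (((hY.kernel t).measurable_coe hS).comp (comap_measurable (Y s)))
    (fun ω => prob_le_one) hTK (by
      rw [Set.univ_inter, Set.indicator_univ, condExp_const hle]
      exact Eventually.of_forall fun ω => (one_mul _).symm)
  simpa using this

theorem IsHomogeneousFragmentation.map_zero : μ.map (Y 0) = Measure.dirac ⊤ := by
  rw [show Y 0 = fun _ => ⊤ from funext hY.zero, Measure.map_const]
  simp

/-- A related pair sees only its own block, so it survives as it would from the one-block partition.
By iteration, survival probabilities on a grid are geometric. -/
theorem IsHomogeneousFragmentation.kernel_rel (t : ℝ≥0) (π : Setoid ℕ) (i j : ℕ) :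
    hY.kernel t π {ρ | ρ.r i j} =
      {ρ : Setoid ℕ | ρ.r i j}.indicator (fun _ => μ.map (Y t) {ρ | ρ.r i j}) π := by
  have := hY.isProbabilityMeasure_map t
  have hset : {ρ : Setoid ℕ | ρ.r i j} = agree {(i, j)} := by
    ext ρ
    simp [agree]
  rw [hY.kernel_eq]
  by_cases hπ : π.r i j
  · rw [Set.indicator_of_mem (show π ∈ {ρ : Setoid ℕ | ρ.r i j} from hπ), hset,
      ← act_indicator _ (measurableSet_agree _)]
    have hloc : LocalTo {i, j} ((agree {(i, j)}).indicator (1 : Setoid ℕ → ℝ≥0∞)) :=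
      localTo_agree fun p hp => by
        rw [Finset.mem_singleton.1 hp]
        simp
    rw [(hloc.act (μ.map (Y t)) (measurable_one.indicator (measurableSet_agree _))).congr
      (ρ := ⊤), act_indicator _ (measurableSet_agree _), fragKer_top]
    rintro k (rfl | rfl) l (rfl | rfl)
    · exact ⟨fun _ => trivial, fun _ => π.refl' _⟩
    · exact ⟨fun _ => trivial, fun _ => hπ⟩
    · exact ⟨fun _ => trivial, fun _ => π.symm' hπ⟩
    · exact ⟨fun _ => trivial, fun _ => π.refl' _⟩
  · rw [Set.indicator_of_notMem (show π ∉ {ρ : Setoid ℕ | ρ.r i j} from hπ), fragKer_apply,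
      Measure.map_apply (measurable_fragment π) (measurableSet_rel i j)]
    refine measure_mono_null (t := ∅) (fun x hx => hπ hx.1) measure_empty

theorem IsHomogeneousFragmentation.map_natMul_rel (h : ℝ≥0) (i j v : ℕ) :
    μ.map (Y (v * h)) {ρ | ρ.r i j} = (μ.map (Y h) {ρ | ρ.r i j}) ^ v := by
  induction v with
  | zero =>
    rw [Nat.cast_zero, zero_mul, hY.map_zero, pow_zero]
    exact Measure.dirac_apply_of_mem trivial
  | succ v ih =>
    rw [Nat.cast_succ, add_mul, one_mul, hY.map_add,
      Measure.bind_apply (measurableSet_rel i j) (Kernel.aemeasurable _)]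
    simp_rw [hY.kernel_rel]
    rw [lintegral_indicator_const (measurableSet_rel i j), ih, pow_succ, mul_comm]

theorem IsHomogeneousFragmentation.dichotomy (h : ℝ≥0) (i j : ℕ) :
    μ.map (Y h) {ρ | ρ.r i j} = 1 ∨ μ {ω | ∀ v : ℕ, (Y (v * h) ω).r i j} = 0 := by
  have := hY.isProbabilityMeasure_map h
  by_cases hq : μ.map (Y h) {ρ | ρ.r i j} = 1
  · exact Or.inl hq
  · right
    have hlt : μ.map (Y h) {ρ | ρ.r i j} < 1 := lt_of_le_of_ne prob_le_one hq
    have hle : ∀ v : ℕ, μ {ω | ∀ v : ℕ, (Y (v * h) ω).r i j} ≤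
        (μ.map (Y h) {ρ | ρ.r i j}) ^ v := by
      intro v
      rw [← hY.map_natMul_rel, Measure.map_apply (hY.branching.measurable _)
        (measurableSet_rel i j)]
      exact measure_mono fun ω hω => hω v
    exact le_antisymm (ge_of_tendsto' (ENNReal.tendsto_pow_atTop_nhds_zero_of_lt_one hlt) hle)
      zero_le

/-- A Markovian path, observed along an arithmetic progression of times. -/
theorem IsHomogeneousFragmentation.isSpineChain {A : ℝ≥0 → Ω → Set ℕ} (hA : IsPath Y A)
    {𝓕 : Filtration ℝ≥0 mΩ} (hAm : Adapted 𝓕 A) (hYm : Adapted 𝓕 Y)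
    (hM : ∀ (s t : ℝ≥0) (S : Set (Setoid ℕ)), MeasurableSet S →
      μ⟦Y (s + t) ⁻¹' S | 𝓕 s⟧ =ᵐ[μ]
        μ⟦Y (s + t) ⁻¹' S | MeasurableSpace.comap (Y s) inferInstance⟧)
    (hI : ∀ s : ℝ≥0, CondIndependent μ (𝓕 s) (insideFuture Y A s) (outsideFuture Y A s))
    (h : ℝ≥0) [IsProbabilityMeasure (μ.map (Y h))] :
    IsSpineChain μ (μ.map (Y h)) (fun v : ℕ => Y (v * h)) (fun v : ℕ => A (v * h))
      (fun v : ℕ => 𝓕 (v * h)) where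
  le v := 𝓕.le _
  mono v w hvw := 𝓕.mono (mul_le_mul_left (Nat.cast_le.2 hvw) h)
  measurable_y v := hYm _
  measurable_a v := hAm _
  antitone_y ω v w hvw := hY.branching.refining ω (mul_le_mul_left (Nat.cast_le.2 hvw) h)
  antitone_a ω v w hvw := hA.decreasing ω (mul_le_mul_left (Nat.cast_le.2 hvw) h)
  mem_iff_rel hm := hA.mem_iff_rel hm
  dichotomy i j := hY.dichotomy h i j
  split := by
    intro v G hG F hGF
    let s : ℝ≥0 := v * h
    have hsh : ((v + 1 : ℕ) : ℝ≥0) * h = s + h := by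
      simp only [s]
      push_cast
      ring
    rw [hsh]
    have hAs : Measurable (A s) := (hAm s).mono (𝓕.le s) le_rfl
    have hYt : ∀ t, Measurable (Y t) := hY.branching.measurable
    have hrestr : ∀ t, Measurable fun ω => restrict (Y t ω) (A s ω) := by
      intro t
      refine measurable_set_iff.2 fun p => measurableSet_setOfPred.1 ?_
      exact (measurableSet_mem_of_measurable hAs p.1).inter
        ((measurableSet_mem_of_measurable hAs p.2).inter
          (hYt t (measurableSet_rel p.1 p.2)))
    have hin : insideFuture Y A s ≤ mΩ := iSup₂_le fun t _ => Measurable.comap_le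
      ((((hAm t).mono (𝓕.le t) le_rfl)).prodMk (hrestr t))
    have hchain : insideChain (fun v : ℕ => Y (v * h)) (fun v : ℕ => A (v * h)) v ≤
        insideFuture Y A s := by
      refine iSup₂_le fun w hw => Measurable.comap_le ?_
      have hm : Measurable[insideFuture Y A s]
          fun ω => (A (w * h) ω, restrict (Y (w * h) ω) (A s ω)) :=
        Measurable.mono (comap_measurable _)
          (le_iSup₂_of_le (w * h : ℝ≥0) (mul_le_mul_left (Nat.cast_le.2 hw) h) le_rfl) le_rfl
      refine Measurable.prodMk (measurable_fst.comp hm) ?_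
      refine @measurable_of_rel _ (insideFuture Y A s) _ fun i j => ?_
      refine @MeasurableSet.union _ (insideFuture Y A s) _ _ (MeasurableSet.const _) ?_
      exact measurableSet_mem_of_measurable (measurable_snd.comp hm) (i, j)
    let D : Set Ω := {ω | ∀ p ∈ F, p.1 ∉ A s ω ∧ p.2 ∉ A s ω}
    have hD : MeasurableSet[𝓕 s] D := by
      have : D = ⋂ p ∈ F, ({ω | p.1 ∈ A s ω}ᶜ ∩ {ω | p.2 ∈ A s ω}ᶜ) := by
        ext ω
        simp [D]
      rw [this]
      have hi : ∀ i, MeasurableSet[𝓕 s] {ω | i ∈ A s ω} := fun i =>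
        measurableSet_mem_of_measurable (hAm s) i
      exact Finset.measurableSet_biInter _ fun p _ => (hi p.1).compl.inter (hi p.2).compl
    -- Without `D` the event need not be measurable for the outside future, since pairs could lie in
    -- `A s`. The event `D` is known at time `s` and contains `G`.
    let T : Set Ω := D ∩ Y (s + h) ⁻¹' agree F
    have hFm := measurableSet_agree F
    have hT : MeasurableSet T := (𝓕.le s _ hD).inter (hYt _ hFm)
    have hTout : MeasurableSet[outsideFuture Y A s] T := by
      have hm : Measurable[outsideFuture Y A s]
          fun ω => restrict (Y (s + h) ω) (A s ω)ᶜ :=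
        Measurable.mono (comap_measurable _)
          (le_iSup₂_of_le (s + h) le_self_add le_rfl) le_rfl
      have : T = ⋂ p ∈ F, {ω | p ∈ restrict (Y (s + h) ω) (A s ω)ᶜ} := by
        ext ω
        simp only [Set.mem_iInter]
        exact ⟨fun hω p hp => ⟨(hω.1 p hp).1, (hω.1 p hp).2, hω.2 p hp⟩,
          fun hω => ⟨fun p hp => ⟨(hω p hp).1, (hω p hp).2.1⟩, fun p hp => (hω p hp).2.2⟩⟩
      rw [this]
      exact Finset.measurableSet_biInter _ fun p _ =>
        measurableSet_mem_of_measurable hm p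
    let K : Ω → ℝ≥0∞ := D.indicator fun ω => hY.kernel h (Y s ω) (agree F)
    have hKm : Measurable[𝓕 s] K :=
      Measurable.indicator (((hY.kernel h).measurable_coe hFm).comp (hYm s)) hD
    have hK1 : ∀ ω, K ω ≤ 1 := fun ω => by
      by_cases hω : ω ∈ D
      · simp only [K, Set.indicator_of_mem hω]
        exact prob_le_one
      · simp only [K, Set.indicator_of_notMem hω]
        exact zero_le_one
    have hTK : μ⟦T | 𝓕 s⟧ =ᵐ[μ] fun ω => (K ω).toReal := by
      have h1 : T.indicator (fun _ => (1 : ℝ)) =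
          D.indicator ((Y (s + h) ⁻¹' agree F).indicator fun _ => (1 : ℝ)) :=
        (Set.indicator_indicator _ _ _).symm
      rw [h1]
      refine (condExp_indicator ((integrable_const 1).indicator (hYt _ hFm)) hD).trans ?_
      filter_upwards [(hM s h _ hFm).trans (hY.markov_comap s h hFm)] with ω hω
      by_cases hωD : ω ∈ D
      · rw [Set.indicator_of_mem hωD, hω]
        simp only [K, Set.indicator_of_mem hωD]
      · rw [Set.indicator_of_notMem hωD]
        simp only [K, Set.indicator_of_notMem hωD, ENNReal.toReal_zero]
    -- Conditional independence treats intersections of a past event with an inside event; these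
    -- form a `π`-system generating the joint `σ`-algebra.
    have key : (μ.restrict T) G = (μ.withDensity K) G := by
      have hKm' : Measurable K := hKm.mono (𝓕.le s) le_rfl
      refine measure_eq_of_sup (𝓕.le s) (hchain.trans hin) (fun B S hB hS => ?_) hG
      have hS' := hchain _ hS
      have hBm := 𝓕.le s _ hB
      rw [Measure.restrict_apply (hBm.inter (hin _ hS')),
        withDensity_apply _ (hBm.inter (hin _ hS'))]
      exact measure_inter_of_condIndep (𝓕.le s) (hin _ hS') hT hB hKm hK1 hTK (hI s S T hS' hTout)
    have hGm : MeasurableSet G := sup_le (𝓕.le s) (hchain.trans hin) _ hG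
    have hGD : G ⊆ D := fun ω hω => hGF ω hω
    rw [Measure.restrict_apply hGm, withDensity_apply _ hGm] at key
    have hGT : G ∩ T = G ∩ Y (s + h) ⁻¹' agree F := by
      ext ω
      exact ⟨fun hω => ⟨hω.1, hω.2.2⟩, fun hω => ⟨hω.1, hGD hω.1, hω.2⟩⟩
    rw [← hGT, key]
    exact setLIntegral_congr_fun hGm fun ω hω => Set.indicator_of_mem (hGD hω) _

end Fragmentation

/-! ### Grids and pathwise convergence of the discrete spinal chains -/

section Discretization

/-- The mesh of the grid used at stage `k`. -/
noncomputable def mesh (k : ℕ) : ℝ≥0 := ((k : ℝ≥0) + 1)⁻¹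

/-- The index of the first point of the grid of stage `k` that is at least `u`. -/
noncomputable def gridIndex (k : ℕ) (u : ℝ≥0) : ℕ := ⌈u * ((k : ℝ≥0) + 1)⌉₊

theorem natCast_mul_mesh_lt_iff {k w : ℕ} {u : ℝ≥0} : (w : ℝ≥0) * mesh k < u ↔ w < gridIndex k u := by
  have hk : (0 : ℝ≥0) < (k : ℝ≥0) + 1 := by positivity
  rw [gridIndex, Nat.lt_ceil, mesh, ← div_eq_mul_inv, div_lt_iff₀ hk]

theorem le_gridIndex_mul_mesh (k : ℕ) (u : ℝ≥0) : u ≤ gridIndex k u * mesh k := by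
  by_contra! h
  exact lt_irrefl _ (natCast_mul_mesh_lt_iff.1 h)

theorem gridIndex_mono (k : ℕ) : Monotone (gridIndex k) := fun _ _ h =>
  Nat.ceil_mono (mul_le_mul_left h _)

theorem tendsto_mesh : Tendsto mesh atTop (𝓝 0) := by
  rw [← NNReal.tendsto_coe]
  have h : (fun k => (mesh k : ℝ)) = fun k : ℕ => 1 / ((k : ℝ) + 1) := by
    funext k
    simp [mesh]
  rw [h]
  exact tendsto_one_div_add_atTop_nhds_zero_nat

theorem tendsto_gridIndex_mul_mesh (u : ℝ≥0) :
    Tendsto (fun k => (gridIndex k u : ℝ≥0) * mesh k) atTop (𝓝[≥] u) := by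
  refine tendsto_nhdsWithin_iff.2
    ⟨?_, Eventually.of_forall fun k => le_gridIndex_mul_mesh k u⟩
  have h2 : Tendsto (fun k => u + mesh k) atTop (𝓝 u) := by
    simpa using tendsto_const_nhds.add tendsto_mesh
  refine tendsto_of_tendsto_of_tendsto_of_le_of_le tendsto_const_nhds h2
    (fun k => le_gridIndex_mul_mesh k u) fun k => ?_
  have hk : (0 : ℝ≥0) < (k : ℝ≥0) + 1 := by positivity
  have h1 : (gridIndex k u : ℝ≥0) ≤ u * ((k : ℝ≥0) + 1) + 1 := (Nat.ceil_lt_add_one zero_le).le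
  calc (gridIndex k u : ℝ≥0) * mesh k ≤ (u * ((k : ℝ≥0) + 1) + 1) * mesh k :=
        mul_le_mul_left h1 _
    _ = u + mesh k := by
        rw [mesh, add_mul, one_mul, mul_assoc, mul_inv_cancel₀ hk.ne', mul_one]

theorem tendsto_add_nhdsGE {α : Type*} {l : Filter α} {f g : α → ℝ≥0} {u v : ℝ≥0}
    (hf : Tendsto f l (𝓝[≥] u)) (hg : Tendsto g l (𝓝[≥] v)) :
    Tendsto (fun k => f k + g k) l (𝓝[≥] (u + v)) := by
  rw [tendsto_nhdsWithin_iff] at hf hg ⊢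
  refine ⟨hf.1.add hg.1, ?_⟩
  filter_upwards [hf.2, hg.2] with k h1 h2
  exact add_le_add (Set.mem_Ici.1 h1) (Set.mem_Ici.1 h2)

variable {Ω : Type*} {Y : ℝ≥0 → Ω → Setoid ℕ} {A : ℝ≥0 → Ω → Set ℕ}

/-- The spinal chain of the process observed on the grid of stage `k`. -/
noncomputable def gridSpinal (Y : ℝ≥0 → Ω → Setoid ℕ) (A : ℝ≥0 → Ω → Set ℕ) (k l : ℕ) (ω : Ω) :
    Setoid ℕ :=
  spinalChain (fun v : ℕ => Y (v * mesh k)) (fun v : ℕ => A (v * mesh k)) l ω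

variable (hA : IsPath Y A) (ha : ∀ ω, Antitone fun t => Y t ω)
  (hr : ∀ ω, IsRightContinuous fun t => Y t ω)

include hA hr

theorem lt_exitIndex_grid_iff {k w n : ℕ} {ω : Ω} :
    (w : ℕ∞) < exitIndex (fun v : ℕ => A (v * mesh k)) n ω ↔
      ((w * mesh k : ℝ≥0) : ℝ≥0∞) < exitTime A n ω := by
  have hanti : Antitone fun v : ℕ => A (v * mesh k) ω := fun v w hvw =>
    hA.decreasing ω (mul_le_mul_left (Nat.cast_le.2 hvw) _)
  rw [← mem_iff_lt_exitIndex_of_antitone (a := fun v : ℕ => A (v * mesh k)) hanti]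
  exact hA.mem_iff_lt_exitTime hr

theorem exitIndex_grid_of_coe {k n : ℕ} {ω : Ω} {v : ℝ≥0} (h : exitTime A n ω = v) :
    exitIndex (fun v : ℕ => A (v * mesh k)) n ω = gridIndex k v := by
  have key : ∀ w : ℕ, (w : ℕ∞) < exitIndex (fun v : ℕ => A (v * mesh k)) n ω ↔
      (w : ℕ∞) < gridIndex k v := by
    intro w
    rw [lt_exitIndex_grid_iff hA hr, h, ENNReal.coe_lt_coe, natCast_mul_mesh_lt_iff, Nat.cast_lt]
  refine le_antisymm ?_ ?_
  · by_contra! hlt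
    exact lt_irrefl _ ((key _).1 hlt)
  · by_contra! hlt
    lift exitIndex (fun v : ℕ => A (v * mesh k)) n ω to ℕ using
      (hlt.trans (ENat.natCast_lt_top _)).ne with w hw
    have := (key w).2 hlt
    exact lt_irrefl _ (hw ▸ this)

theorem exitIndex_grid_of_top {k n : ℕ} {ω : Ω} (h : exitTime A n ω = ∞) :
    exitIndex (fun v : ℕ => A (v * mesh k)) n ω = ⊤ := by
  by_contra hne
  lift exitIndex (fun v : ℕ => A (v * mesh k)) n ω to ℕ using hne with w hw
  have : (w : ℕ∞) < exitIndex (fun v : ℕ => A (v * mesh k)) n ω :=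
    (lt_exitIndex_grid_iff hA hr).2 (h ▸ ENNReal.coe_lt_top)
  exact lt_irrefl _ (hw ▸ this)

/-- The grid exit time of `i` tends to its finite exit time, hence eventually falls strictly before
the exit of `j`. -/
theorem eventually_exitIndex_grid_ne {i j : ℕ} {ω : Ω} (h : exitTime A i ω < exitTime A j ω) :
    ∀ᶠ k in atTop, exitIndex (fun v : ℕ => A (v * mesh k)) i ω ≠
      exitIndex (fun v : ℕ => A (v * mesh k)) j ω := by
  lift exitTime A i ω to ℝ≥0 using (h.trans_le le_top).ne with v hv
  have h1 : Tendsto (fun k => (((gridIndex k v : ℝ≥0) * mesh k : ℝ≥0) : ℝ≥0∞)) atTop (𝓝 (v : ℝ≥0∞)) :=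
    (ENNReal.continuous_coe.tendsto v).comp
      ((tendsto_gridIndex_mul_mesh v).mono_right nhdsWithin_le_nhds)
  filter_upwards [h1.eventually (Iio_mem_nhds h)] with k hk
  have hj := (lt_exitIndex_grid_iff (n := j) hA hr).2 hk
  rw [exitIndex_grid_of_coe hA hr hv.symm]
  exact hj.ne

include ha

/-- For equal finite exit times the grid reads `Y` at times converging from the right to the exit
time plus `u`, and `Y` is right-continuous. For two infinite exit times both relations hold always;
unequal exit times are eventually detected by the grid. -/
theorem eventually_gridSpinal_rel {l : ℕ → ℕ} {u : ℝ≥0}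
    (hl : Tendsto (fun k => (l k : ℝ≥0) * mesh k) atTop (𝓝[≥] u)) (ω : Ω) (i j : ℕ) :
    ∀ᶠ k in atTop, ((gridSpinal Y A k (l k) ω).r i j ↔ (spinal Y A u ω).r i j) := by
  rcases lt_trichotomy (exitTime A i ω) (exitTime A j ω) with hij | hij | hij
  · filter_upwards [eventually_exitIndex_grid_ne hA hr hij] with k hk
    rw [spinal_rel hA ha hr]
    exact iff_of_false (fun h => hk h.1) (fun h => hij.ne h.1)
  · have hmid : ∀ᶠ k in atTop, ((gridSpinal Y A k (l k) ω).r i j ↔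
        (atTime (fun s => Y s ω) (exitTime A j ω + u)).r i j) := by
      induction hj : exitTime A j ω with
      | top =>
        refine Eventually.of_forall fun k => iff_of_true ⟨?_, fun g hg => ?_⟩ ?_
        · rw [exitIndex_grid_of_top hA hr (hij.trans hj), exitIndex_grid_of_top hA hr hj]
        · rw [exitIndex_grid_of_top hA hr (hij.trans hj)] at hg
          exact absurd hg.symm (ENat.natCast_ne_top g)
        · rw [top_add, atTime_top, iInf_rel]
          intro s
          refine (hA.mem_iff_rel ?_).1 ?_
          · exact (hA.mem_iff_lt_exitTime hr).2 (hj ▸ ENNReal.coe_lt_top)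
          · exact (hA.mem_iff_lt_exitTime hr).2 (hij.trans hj ▸ ENNReal.coe_lt_top)
      | coe v =>
        have ht := tendsto_add_nhdsGE (tendsto_gridIndex_mul_mesh v) hl
        filter_upwards [ht.eventually (hr ω (v + u) i j)] with k hk
        rw [← ENNReal.coe_add, atTime_coe, ← hk]
        change _ ∧ _ ↔ _
        rw [exitIndex_grid_of_coe hA hr (hij.trans hj), exitIndex_grid_of_coe hA hr hj, ← add_mul,
          ← Nat.cast_add]
        exact ⟨fun h => h.2 _ rfl, fun h => ⟨rfl, fun g hg => Nat.cast_injective hg ▸ h⟩⟩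
    filter_upwards [hmid] with k hk
    rw [hk, spinal_rel hA ha hr]
    exact ⟨fun h => ⟨hij, h⟩, fun h => h.2⟩
  · filter_upwards [eventually_exitIndex_grid_ne hA hr hij] with k hk
    rw [spinal_rel hA ha hr]
    exact iff_of_false (fun h => hk h.1.symm) (fun h => hij.ne' h.1)

end Discretization

/-! ### Right-continuity of the fragmentation kernel on cylinder events -/

section Continuity

theorem eventually_agree_iff {α : Type*} {l : Filter α} {p : α → Setoid ℕ} {π : Setoid ℕ}
    (h : ∀ i j, ∀ᶠ k in l, ((p k).r i j ↔ π.r i j)) (F : Finset (ℕ × ℕ)) :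
    ∀ᶠ k in l, (p k ∈ agree F ↔ π ∈ agree F) := by
  have := (eventually_all_finset F).2 fun q _ => h q.1 q.2
  filter_upwards [this] with k hk
  exact forall₂_congr fun q hq => hk q hq

theorem eventually_agreeInd_eq {α : Type*} {l : Filter α} {p : α → Setoid ℕ} {π : Setoid ℕ}
    (h : ∀ i j, ∀ᶠ k in l, ((p k).r i j ↔ π.r i j)) (F : Finset (ℕ × ℕ)) :
    ∀ᶠ k in l, agreeInd F (p k) = agreeInd F π := by
  filter_upwards [eventually_agree_iff h F] with k hk
  by_cases hπ : π ∈ agree F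
  · rw [agreeInd_eq_one hπ, agreeInd_eq_one (hk.2 hπ)]
  · rw [agreeInd_eq_zero hπ, agreeInd_eq_zero (mt hk.1 hπ)]

theorem agreeInd_le_one (F : Finset (ℕ × ℕ)) (π : Setoid ℕ) : agreeInd F π ≤ 1 :=
  Set.indicator_le_self' (fun _ _ => zero_le) π

variable {Ω : Type*} [mΩ : MeasurableSpace Ω] {μ : Measure Ω} [IsProbabilityMeasure μ]
  {Y : ℝ≥0 → Ω → Setoid ℕ} (hY : IsHomogeneousFragmentation μ Y)

include hY

/-- All times `t` are realized on one product space of independent copies of `Y`, so path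
right-continuity can be used under the integral. -/
theorem IsHomogeneousFragmentation.kernel_agree (t : ℝ≥0) (π : Setoid ℕ) (F : Finset (ℕ × ℕ)) :
    hY.kernel t π (agree F) = ∫⁻ x, agreeInd F (fragment π fun n => Y t (x n))
      ∂(Measure.infinitePi fun _ : ℕ => μ) := by
  have := hY.isProbabilityMeasure_map t
  have hm : Measurable fun (x : ℕ → Ω) (n : ℕ) => Y t (x n) :=
    measurable_pi_iff.2 fun n => (hY.branching.measurable t).comp (measurable_pi_apply n)
  rw [hY.kernel_eq, ← act_indicator _ (measurableSet_agree F)]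
  change act _ (agreeInd F) π = _
  rw [act, lintegral_fragKer _ _ (measurable_agreeInd F),
    ← Measure.infinitePi_map_pi (fun _ : ℕ => μ) (f := fun _ => Y t)
      (fun _ => hY.branching.measurable t)]
  exact lintegral_map ((measurable_agreeInd F).comp (measurable_fragment π)) hm

theorem IsHomogeneousFragmentation.tendsto_kernel_agree {t : ℝ≥0} {τ : ℕ → ℝ≥0}
    (hτ : Tendsto τ atTop (𝓝[≥] t)) (π : Setoid ℕ) (F : Finset (ℕ × ℕ)) :
    Tendsto (fun k => hY.kernel (τ k) π (agree F)) atTop (𝓝 (hY.kernel t π (agree F))) := by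
  simp_rw [hY.kernel_agree]
  have hm : ∀ t, Measurable fun x : ℕ → Ω => agreeInd F (fragment π fun n => Y t (x n)) :=
    fun t => (measurable_agreeInd F).comp ((measurable_fragment π).comp
      (measurable_pi_iff.2 fun n => (hY.branching.measurable t).comp (measurable_pi_apply n)))
  refine tendsto_lintegral_of_dominated_convergence (fun _ => 1) (fun k => hm _)
    (fun k => Eventually.of_forall fun x => agreeInd_le_one _ _) (by simp)
    (Eventually.of_forall fun x => ?_)
  refine tendsto_nhds_of_eventually_eq (eventually_agreeInd_eq (fun i j => ?_) F)
  filter_upwards [hτ.eventually (hY.branching.rightContinuous (x (least π i)) t i j)] with k hk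
  rw [fragment_rel, fragment_rel, hk]

theorem IsHomogeneousFragmentation.eventually_kernel_agree {α : Type*} {l : Filter α}
    {p : α → Setoid ℕ} {π : Setoid ℕ} (h : ∀ i j, ∀ᶠ k in l, ((p k).r i j ↔ π.r i j))
    (τ : α → ℝ≥0) (F : Finset (ℕ × ℕ)) :
    ∀ᶠ k in l, hY.kernel (τ k) (p k) (agree F) = hY.kernel (τ k) π (agree F) := by
  classical
  let W : Finset ℕ := F.image Prod.fst ∪ F.image Prod.snd
  have hW : ∀ q ∈ F, q.1 ∈ (W : Set ℕ) ∧ q.2 ∈ (W : Set ℕ) := fun q hq =>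
    ⟨Finset.mem_coe.2 (Finset.mem_union_left _ (Finset.mem_image_of_mem _ hq)),
      Finset.mem_coe.2 (Finset.mem_union_right _ (Finset.mem_image_of_mem _ hq))⟩
  have hall : ∀ᶠ k in l, ∀ i ∈ W, ∀ j ∈ W, ((p k).r i j ↔ π.r i j) :=
    (eventually_all_finset W).2 fun i _ => (eventually_all_finset W).2 fun j _ => h i j
  filter_upwards [hall] with k hk
  have := hY.isProbabilityMeasure_map (τ k)
  rw [hY.kernel_eq, ← act_indicator _ (measurableSet_agree F),
    ← act_indicator _ (measurableSet_agree F)]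
  exact ((localTo_agree hW).act _ (measurable_agreeInd F)).congr fun i hi j hj =>
    hk i (Finset.mem_coe.1 hi) j (Finset.mem_coe.1 hj)

end Continuity

/-! ### Passage to the limit and the conditional Markov property -/

section Limit

variable {Ω : Type*} {Y : ℝ≥0 → Ω → Setoid ℕ} {A : ℝ≥0 → Ω → Set ℕ}

theorem IsPath.measurable_exitTime {m : MeasurableSpace Ω} (hA : IsPath Y A)
    (hr : ∀ ω, IsRightContinuous fun t => Y t ω) (n : ℕ)
    (h : ∀ t, MeasurableSet {ω | n ∈ A t ω}) : Measurable (exitTime A n) := by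
  refine measurable_of_Ioi fun x => ?_
  induction x with
  | top =>
    rw [Set.Ioi_top, Set.preimage_empty]
    exact MeasurableSet.empty
  | coe x =>
    have : exitTime A n ⁻¹' Set.Ioi (x : ℝ≥0∞) = {ω | n ∈ A x ω} := by
      ext ω
      exact (hA.mem_iff_lt_exitTime hr).symm
    rw [this]
    exact h x

/-- The event that the labels in `Q` are still in `A` at given times and that the pairs in `T` are
related in the spinal process at given times. -/
def spinalEvent (Y : ℝ≥0 → Ω → Setoid ℕ) (A : ℝ≥0 → Ω → Set ℕ) (Q : Finset (ℕ × ℝ≥0))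
    (T : Finset ((ℕ × ℕ) × ℝ≥0)) : Set Ω :=
  {ω | (∀ q ∈ Q, q.1 ∈ A q.2 ω) ∧ ∀ p ∈ T, (spinal Y A p.2 ω).r p.1.1 p.1.2}

/-- The approximation of `spinalEvent` on the grid of stage `k`. -/
def gridEvent (Y : ℝ≥0 → Ω → Setoid ℕ) (A : ℝ≥0 → Ω → Set ℕ) (Q : Finset (ℕ × ℝ≥0))
    (T : Finset ((ℕ × ℕ) × ℝ≥0)) (k : ℕ) : Set Ω :=
  {ω | (∀ q ∈ Q, q.1 ∈ A (gridIndex k q.2 * mesh k) ω) ∧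
    ∀ p ∈ T, (gridSpinal Y A k (gridIndex k p.2) ω).r p.1.1 p.1.2}

theorem spinalEvent_inter [DecidableEq ℝ≥0] (Q Q' : Finset (ℕ × ℝ≥0))
    (T T' : Finset ((ℕ × ℕ) × ℝ≥0)) :
    spinalEvent Y A Q T ∩ spinalEvent Y A Q' T' = spinalEvent Y A (Q ∪ Q') (T ∪ T') := by
  ext ω
  simp only [spinalEvent, Set.mem_inter_iff, Set.mem_ofPred_eq, Finset.mem_union, or_imp,
    forall_and]
  tauto

theorem eventually_mem_gridEvent_iff (hA : IsPath Y A) (ha : ∀ ω, Antitone fun t => Y t ω)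
    (hr : ∀ ω, IsRightContinuous fun t => Y t ω) (Q : Finset (ℕ × ℝ≥0))
    (T : Finset ((ℕ × ℕ) × ℝ≥0)) (ω : Ω) :
    ∀ᶠ k in atTop, (ω ∈ gridEvent Y A Q T k ↔ ω ∈ spinalEvent Y A Q T) := by
  have hQ : ∀ᶠ k in atTop, ∀ q ∈ Q, (q.1 ∈ A (gridIndex k q.2 * mesh k) ω ↔ q.1 ∈ A q.2 ω) := by
    refine (eventually_all_finset Q).2 fun q _ => ?_
    by_cases hq : q.1 ∈ A q.2 ω
    · filter_upwards [(tendsto_gridIndex_mul_mesh q.2).eventually (hA.eventually_mem hr hq)]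
        with k hk
      exact iff_of_true hk hq
    · exact Eventually.of_forall fun k =>
        iff_of_false (fun h => hq (hA.decreasing ω (le_gridIndex_mul_mesh k q.2) h)) hq
  have hT : ∀ᶠ k in atTop, ∀ p ∈ T, ((gridSpinal Y A k (gridIndex k p.2) ω).r p.1.1 p.1.2 ↔
      (spinal Y A p.2 ω).r p.1.1 p.1.2) :=
    (eventually_all_finset T).2 fun p _ =>
      eventually_gridSpinal_rel hA ha hr (tendsto_gridIndex_mul_mesh p.2) ω _ _
  filter_upwards [hQ, hT] with k h1 h2
  exact and_congr (forall₂_congr h1) (forall₂_congr h2)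

variable [mΩ : MeasurableSpace Ω] {μ : Measure Ω} [IsProbabilityMeasure μ] (hY : IsHomogeneousFragmentation μ Y)

/-- The defining properties of a Markovian path along the grid of every stage. -/
def IsGridSpine (hY : IsHomogeneousFragmentation μ Y) (A : ℝ≥0 → Ω → Set ℕ) : Prop :=
  ∀ k, ∃ 𝓕 : ℕ → MeasurableSpace Ω,
    haveI := hY.isProbabilityMeasure_map (mesh k)
    IsSpineChain μ (μ.map (Y (mesh k))) (fun v : ℕ => Y (v * mesh k))
      (fun v : ℕ => A (v * mesh k)) 𝓕

variable {hY} (hG : IsGridSpine hY A)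

include hG

theorem IsGridSpine.measurable_gridSpinal (k l : ℕ) : Measurable (gridSpinal Y A k l) := by
  obtain ⟨𝓕, h⟩ := hG k
  have := hY.isProbabilityMeasure_map (mesh k)
  exact h.measurable_spinalChain l

/-- The spinal process evaluates `Y` at random times; measurability comes from the pointwise
stabilization of the grid versions. -/
theorem IsGridSpine.measurable_spinal (hA : IsPath Y A) (t : ℝ≥0) :
    Measurable (spinal Y A t) := by
  refine measurable_of_rel fun i j => ?_
  have hev := fun ω => eventually_gridSpinal_rel hA hY.branching.refining
    hY.branching.rightContinuous (tendsto_gridIndex_mul_mesh t) ω i j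
  have : {ω | (spinal Y A t ω).r i j} =
      ⋃ n : ℕ, ⋂ k ≥ n, gridSpinal Y A k (gridIndex k t) ⁻¹' {π | π.r i j} := by
    ext ω
    rw [show (ω ∈ ⋃ n : ℕ, ⋂ k ≥ n, gridSpinal Y A k (gridIndex k t) ⁻¹' {π | π.r i j}) ↔
      ∀ᶠ k in atTop, (gridSpinal Y A k (gridIndex k t) ω).r i j by
        simp [eventually_atTop]]
    constructor
    · intro h
      exact (hev ω).mono fun k hk => hk.2 h
    · intro h
      obtain ⟨k, hk1, hk2⟩ := ((hev ω).and h).exists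
      exact hk1.1 hk2
  rw [this]
  exact MeasurableSet.iUnion fun n => MeasurableSet.iInter fun k => MeasurableSet.iInter fun _ =>
    hG.measurable_gridSpinal k _ (measurableSet_rel i j)

theorem IsGridSpine.measurableSet_gridEvent (hAm : ∀ t, Measurable (A t)) (Q : Finset (ℕ × ℝ≥0))
    (T : Finset ((ℕ × ℕ) × ℝ≥0)) (k : ℕ) : MeasurableSet (gridEvent Y A Q T k) := by
  have : gridEvent Y A Q T k = (⋂ q ∈ Q, {ω | q.1 ∈ A (gridIndex k q.2 * mesh k) ω}) ∩
      ⋂ p ∈ T, gridSpinal Y A k (gridIndex k p.2) ⁻¹' {π | π.r p.1.1 p.1.2} := by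
    ext ω
    simp [gridEvent]
  rw [this]
  exact (Finset.measurableSet_biInter _ fun q _ => measurableSet_mem_of_measurable (hAm _) _).inter
    (Finset.measurableSet_biInter _ fun p _ =>
      hG.measurable_gridSpinal k _ (measurableSet_rel _ _))

theorem IsGridSpine.measurableSet_spinalEvent (hA : IsPath Y A) (hAm : ∀ t, Measurable (A t))
    (Q : Finset (ℕ × ℝ≥0)) (T : Finset ((ℕ × ℕ) × ℝ≥0)) :
    MeasurableSet (spinalEvent Y A Q T) := by
  have : spinalEvent Y A Q T = (⋂ q ∈ Q, {ω | q.1 ∈ A q.2 ω}) ∩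
      ⋂ p ∈ T, spinal Y A p.2 ⁻¹' {π | π.r p.1.1 p.1.2} := by
    ext ω
    simp [spinalEvent]
  rw [this]
  exact (Finset.measurableSet_biInter _ fun q _ => measurableSet_mem_of_measurable (hAm _) _).inter
    (Finset.measurableSet_biInter _ fun p _ =>
      hG.measurable_spinal hA _ (measurableSet_rel _ _))

theorem IsGridSpine.lintegral_gridEvent (Q : Finset (ℕ × ℝ≥0))
    (T : Finset ((ℕ × ℕ) × ℝ≥0)) {s t : ℝ≥0} (hT : ∀ p ∈ T, p.2 ≤ s) (F : Finset (ℕ × ℕ))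
    (k : ℕ) :
    ∫⁻ ω in gridEvent Y A Q T k,
        agreeInd F (gridSpinal Y A k (gridIndex k s + gridIndex k t) ω) ∂μ =
      ∫⁻ ω in gridEvent Y A Q T k,
        hY.kernel (gridIndex k t * mesh k) (gridSpinal Y A k (gridIndex k s) ω) (agree F) ∂μ := by
  classical
  obtain ⟨𝓕, h⟩ := hG k
  have hprob := fun t => hY.isProbabilityMeasure_map t
  let Q' : Finset (ℕ × ℕ) := Q.image fun q => (q.1, gridIndex k q.2)
  let Φ : ℕ → Finset (ℕ × ℕ) := fun l => (T.filter fun p => gridIndex k p.2 = l).image Prod.fst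
  let W : Finset ℕ := (T.image fun p => p.1.1) ∪ T.image fun p => p.1.2
  have hΦ : ∀ l, ∀ p ∈ Φ l, p.1 ∈ W ∧ p.2 ∈ W := by
    intro l p hp
    obtain ⟨q, hq, rfl⟩ := Finset.mem_image.1 hp
    have hqT := (Finset.mem_filter.1 hq).1
    exact ⟨Finset.mem_union_left _ (Finset.mem_image_of_mem (fun p => p.1.1) hqT),
      Finset.mem_union_right _ (Finset.mem_image_of_mem (fun p => p.1.2) hqT)⟩
  have hGeq : gridEvent Y A Q T k = {ω | (∀ q ∈ Q', q.1 ∈ A (q.2 * mesh k) ω) ∧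
      ∀ l ≤ gridIndex k s, gridSpinal Y A k l ω ∈ agree (Φ l)} := by
    ext ω
    constructor
    · rintro ⟨h1, h2⟩
      refine ⟨fun q hq => ?_, fun l _ p hp => ?_⟩
      · obtain ⟨q', hq', rfl⟩ := Finset.mem_image.1 hq
        exact h1 q' hq'
      · obtain ⟨q, hq, rfl⟩ := Finset.mem_image.1 hp
        obtain ⟨hqT, rfl⟩ := Finset.mem_filter.1 hq
        exact h2 q hqT
    · rintro ⟨h1, h2⟩
      refine ⟨fun q hq => h1 _ (Finset.mem_image_of_mem _ hq), fun p hp => ?_⟩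
      exact h2 _ (gridIndex_mono k (hT p hp)) p.1
        (Finset.mem_image_of_mem _ (Finset.mem_filter.2 ⟨hp, rfl⟩))
  have hmarkov := h.map_spinalChain_add hΦ Q' (gridIndex k s) hGeq
    (R := fun m : ℕ => μ.map (Y (m * mesh k))) (by rw [Nat.cast_zero, zero_mul, hY.map_zero])
    (fun m => by
      have : ((m + 1 : ℕ) : ℝ≥0) * mesh k = m * mesh k + mesh k := by push_cast; ring
      rw [this, hY.map_add, hY.kernel_eq]) (gridIndex k t)
  have hFm := measurableSet_agree F
  have hm := h.measurable_spinalChain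
  have e := congrArg (fun ν : Measure (Setoid ℕ) => ∫⁻ ρ, agreeInd F ρ ∂ν) hmarkov
  rw [lintegral_map (measurable_agreeInd F) (hm _),
    Measure.lintegral_bind (Kernel.aemeasurable _) (measurable_agreeInd F).aemeasurable,
    lintegral_map (measurable_agreeInd F).lintegral_kernel (hm _)] at e
  refine e.trans (lintegral_congr fun ω => ?_)
  exact act_indicator _ hFm _

/-- The Markov property of the spinal process, tested on cylinder events. -/
theorem IsGridSpine.lintegral_spinalEvent (hA : IsPath Y A) (hAm : ∀ t, Measurable (A t))
    (Q : Finset (ℕ × ℝ≥0)) (T : Finset ((ℕ × ℕ) × ℝ≥0)) {s t : ℝ≥0} (hT : ∀ p ∈ T, p.2 ≤ s)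
    (F : Finset (ℕ × ℕ)) :
    ∫⁻ ω in spinalEvent Y A Q T, agreeInd F (spinal Y A (s + t) ω) ∂μ =
      ∫⁻ ω in spinalEvent Y A Q T, hY.kernel t (spinal Y A s ω) (agree F) ∂μ := by
  have ha := hY.branching.refining
  have hr := hY.branching.rightContinuous
  have hFm := measurableSet_agree F
  have hGm := hG.measurableSet_gridEvent hAm Q T
  have hSm := hG.measurableSet_spinalEvent hA hAm Q T
  have hs := tendsto_gridIndex_mul_mesh s
  have ht := tendsto_gridIndex_mul_mesh t
  -- The discrete Markov property lands on the sum of the two indices, which may exceed `gridIndex k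
  -- (s + t)`; its grid time still tends to `s + t` from the right.
  have hst : Tendsto (fun k => ((gridIndex k s + gridIndex k t : ℕ) : ℝ≥0) * mesh k) atTop
      (𝓝[≥] (s + t)) := by
    have := tendsto_add_nhdsGE hs ht
    refine this.congr fun k => ?_
    push_cast
    ring
  have hle : ∀ (E : Set Ω) (u : Ω → ℝ≥0∞), (∀ ω, u ω ≤ 1) → ∀ ω, E.indicator u ω ≤ 1 := by
    intro E u hu ω
    by_cases hω : ω ∈ E
    · rw [Set.indicator_of_mem hω]
      exact hu ω
    · rw [Set.indicator_of_notMem hω]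
      exact zero_le_one
  have hlim : ∀ (u : ℕ → Ω → ℝ≥0∞) (u' : Ω → ℝ≥0∞), (∀ k, Measurable (u k)) →
      (∀ k ω, u k ω ≤ 1) → (∀ ω, Tendsto (fun k => u k ω) atTop (𝓝 (u' ω))) →
      Tendsto (fun k => ∫⁻ ω in gridEvent Y A Q T k, u k ω ∂μ) atTop
        (𝓝 (∫⁻ ω in spinalEvent Y A Q T, u' ω ∂μ)) := by
    intro u u' hu hu1 hlim
    simp_rw [← lintegral_indicator (hGm _), ← lintegral_indicator hSm]
    refine tendsto_lintegral_of_dominated_convergence (fun _ => 1)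
      (fun k => (hu k).indicator (hGm k)) (fun k => Eventually.of_forall (hle _ _ (hu1 k)))
      (by simp) (Eventually.of_forall fun ω => ?_)
    have hev := eventually_mem_gridEvent_iff hA ha hr Q T ω
    by_cases hω : ω ∈ spinalEvent Y A Q T
    · rw [Set.indicator_of_mem hω]
      refine (hlim ω).congr' ?_
      filter_upwards [hev] with k hk
      rw [Set.indicator_of_mem (hk.2 hω)]
    · rw [Set.indicator_of_notMem hω]
      refine tendsto_const_nhds.congr' ?_
      filter_upwards [hev] with k hk
      rw [Set.indicator_of_notMem (mt hk.1 hω)]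
  have l1 := hlim (fun k ω => agreeInd F (gridSpinal Y A k (gridIndex k s + gridIndex k t) ω))
    (fun ω => agreeInd F (spinal Y A (s + t) ω))
    (fun k => (measurable_agreeInd F).comp (hG.measurable_gridSpinal k _))
    (fun k ω => agreeInd_le_one _ _)
    (fun ω => tendsto_nhds_of_eventually_eq
      (eventually_agreeInd_eq (fun i j => eventually_gridSpinal_rel hA ha hr hst ω i j) F))
  have l2 := hlim
    (fun k ω => hY.kernel (gridIndex k t * mesh k) (gridSpinal Y A k (gridIndex k s) ω) (agree F))
    (fun ω => hY.kernel t (spinal Y A s ω) (agree F))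
    (fun k => ((hY.kernel _).measurable_coe hFm).comp (hG.measurable_gridSpinal k _))
    (fun k ω => prob_le_one)
    (fun ω => (hY.tendsto_kernel_agree ht (spinal Y A s ω) F).congr'
      ((hY.eventually_kernel_agree
        (fun i j => eventually_gridSpinal_rel hA ha hr hs ω i j) _ F).mono fun k hk => hk.symm))
  simp_rw [hG.lintegral_gridEvent Q T hT F] at l1
  exact tendsto_nhds_unique l1 l2

theorem IsGridSpine.map_spinal_add (hA : IsPath Y A) (hAm : ∀ t, Measurable (A t)) (s t : ℝ≥0)
    {G : Set Ω} (hGm : MeasurableSet[spinalSigma Y A ⊔ past (spinal Y A) s] G) :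
    (μ.restrict G).map (spinal Y A (s + t)) =
      ((μ.restrict G).map (spinal Y A s)).bind (hY.kernel t) := by
  classical
  have hr := hY.branching.rightContinuous
  have hXm := fun u => hG.measurable_spinal hA u
  -- The events `n ∈ A x`, that is `exitTime A n > x`, generate the exit times, and the constraints
  -- in `T` at times `≤ s`, including `0`, generate the spinal past.
  let C : Set (Set Ω) := {E | ∃ Q T, (∀ p ∈ T, p.2 ≤ s) ∧ E = spinalEvent Y A Q T}
  have hC : IsPiSystem C := by
    rintro _ ⟨Q, T, hT, rfl⟩ _ ⟨Q', T', hT', rfl⟩ _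
    refine ⟨Q ∪ Q', T ∪ T', fun p hp => ?_, spinalEvent_inter Q Q' T T'⟩
    exact (Finset.mem_union.1 hp).elim (hT p) (hT' p)
  have hCm : ∀ E ∈ C, MeasurableSet E := by
    rintro _ ⟨Q, T, -, rfl⟩
    exact hG.measurableSet_spinalEvent hA hAm Q T
  have hspinal : ∀ u ≤ s, Measurable[MeasurableSpace.generateFrom C] (spinal Y A u) := by
    intro u hu
    refine @measurable_of_rel _ (MeasurableSpace.generateFrom C) _ fun i j => ?_
    refine MeasurableSpace.measurableSet_generateFrom ⟨∅, {((i, j), u)}, fun p hp => ?_, ?_⟩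
    · rw [Finset.mem_singleton.1 hp]
      exact hu
    · ext ω
      simp [spinalEvent]
  have hexit : ∀ n, Measurable[MeasurableSpace.generateFrom C] (exitTime A n) := by
    intro n
    refine hA.measurable_exitTime hr n fun x => ?_
    refine MeasurableSpace.measurableSet_generateFrom ⟨{(n, x)}, ∅, by simp, ?_⟩
    ext ω
    simp [spinalEvent]
  have hle : spinalSigma Y A ⊔ past (spinal Y A) s ≤ MeasurableSpace.generateFrom C := by
    refine sup_le ?_ (iSup₂_le fun u hu => (hspinal u hu).comap_le)
    have h0 := hspinal 0 zero_le
    have h1 : Measurable[MeasurableSpace.generateFrom C] fun (ω : Ω) (n : ℕ) => exitTime A n ω :=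
      @measurable_pi_lambda _ _ _ (MeasurableSpace.generateFrom C) _ _ hexit
    exact Measurable.comap_le (h0.prodMk h1)
  have hGm' : MeasurableSet G := MeasurableSpace.generateFrom_le hCm _ (hle _ hGm)
  refine ext_agree fun F => ?_
  have hFm := measurableSet_agree F
  -- For fixed `F` both sides are finite measures in `G`, so agreement on the `π`-system `C`
  -- suffices.
  have key : (μ.withDensity fun ω => agreeInd F (spinal Y A (s + t) ω)) G =
      (μ.withDensity fun ω => hY.kernel t (spinal Y A s ω) (agree F)) G := by
    have : IsFiniteMeasure (μ.withDensity fun ω => agreeInd F (spinal Y A (s + t) ω)) := by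
      refine isFiniteMeasure_withDensity (ne_top_of_le_ne_top ENNReal.one_ne_top ?_)
      calc ∫⁻ ω, agreeInd F (spinal Y A (s + t) ω) ∂μ ≤ ∫⁻ _, 1 ∂μ :=
            lintegral_mono fun ω => agreeInd_le_one _ _
        _ = 1 := by simp
    refine measure_eq_of_generateFrom hC hCm ⟨∅, ∅, by simp, by ext; simp [spinalEvent]⟩ ?_
      (hle _ hGm)
    rintro _ ⟨Q, T, hT, rfl⟩
    have hE := hG.measurableSet_spinalEvent hA hAm Q T
    rw [withDensity_apply _ hE, withDensity_apply _ hE]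
    exact hG.lintegral_spinalEvent hA hAm Q T hT F
  rw [withDensity_apply _ hGm', withDensity_apply _ hGm'] at key
  rw [Measure.map_apply (hXm _) hFm, Measure.bind_apply hFm (Kernel.aemeasurable _),
    lintegral_map ((hY.kernel t).measurable_coe hFm) (hXm s), ← key,
    ← lintegral_indicator_one (hXm _ hFm)]
  rfl

/-- Conditionally given the spinal partition and the exit times, the spinal process is a
fragmentation process with the same transition kernel. -/
theorem IsGridSpine.isFragmentationGiven (hA : IsPath Y A) (hAm : ∀ t, Measurable (A t)) :
    IsFragmentationGiven μ (spinalSigma Y A) (transitionKernel μ Y) (spinal Y A) := by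
  have ha := hY.branching.refining
  have hr := hY.branching.rightContinuous
  have hXm := fun u => hG.measurable_spinal hA u
  have hle : spinalSigma Y A ≤ mΩ := Measurable.comap_le
    ((hXm 0).prodMk (measurable_pi_iff.2 fun n => hA.measurable_exitTime hr n fun t =>
      measurableSet_mem_of_measurable (hAm t) n))
  refine ⟨hle, hXm, antitone_spinal hA ha hr, isRightContinuous_spinal hA ha hr, ?_⟩
  intro s t S hS
  have hle' : spinalSigma Y A ⊔ past (spinal Y A) s ≤ mΩ :=
    sup_le hle (iSup₂_le fun u _ => (hXm u).comap_le)
  have hKm : Measurable[spinalSigma Y A ⊔ past (spinal Y A) s]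
      fun ω => (hY.kernel t (spinal Y A s ω) S).toReal := by
    have h1 : Measurable[spinalSigma Y A ⊔ past (spinal Y A) s] (spinal Y A s) :=
      Measurable.mono (comap_measurable _) (le_sup_of_le_right (le_iSup₂_of_le s le_rfl le_rfl))
        le_rfl
    exact (((hY.kernel t).measurable_coe hS).ennreal_toReal).comp h1
  have hKm' : Measurable fun ω => hY.kernel t (spinal Y A s ω) S :=
    ((hY.kernel t).measurable_coe hS).comp (hXm s)
  have hKint : Integrable (fun ω => (hY.kernel t (spinal Y A s ω) S).toReal) μ :=
    Integrable.of_bound hKm'.ennreal_toReal.aestronglyMeasurable 1 (Eventually.of_forall fun ω => by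
      rw [Real.norm_of_nonneg ENNReal.toReal_nonneg]
      exact ENNReal.toReal_le_of_le_ofReal zero_le_one (by simpa using prob_le_one))
  refine (ae_eq_condExp_of_forall_setIntegral_eq hle'
    ((integrable_const (1 : ℝ)).indicator (hXm _ hS)) (fun G _ _ => hKint.integrableOn)
    (fun G hGm _ => ?_) hKm.aestronglyMeasurable).symm
  have e := congrArg (fun ν : Measure (Setoid ℕ) => ν S) (hG.map_spinal_add hA hAm s t hGm)
  rw [Measure.map_apply (hXm _) hS, Measure.bind_apply hS (Kernel.aemeasurable _),
    lintegral_map ((hY.kernel t).measurable_coe hS) (hXm s),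
    ← ofReal_setIntegral_toReal hKm' (fun ω => prob_le_one)] at e
  rw [integral_indicator (hXm _ hS), setIntegral_const, smul_eq_mul, mul_one, Measure.real, e,
    ENNReal.toReal_ofReal (integral_nonneg fun ω => ENNReal.toReal_nonneg)]

end Limit

end HomFrag

theorem mainTheorem10 {Ω : Type*} [MeasurableSpace Ω] (μ : Measure Ω) [IsProbabilityMeasure μ]
    (Y : ℝ≥0 → Ω → Setoid ℕ) (hY : HomFrag.IsHomogeneousFragmentation μ Y)
    (A : ℝ≥0 → Ω → Set ℕ) (hA : HomFrag.IsMarkovianPath μ Y A) :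
    (∀ (t : ℝ≥0) (ω : Ω),
      (HomFrag.spinal Y A t ω).classes = Set.range (HomFrag.spinalBlock Y A t ω) ∧
      (HomFrag.spinal Y A t ω).classes =
        ⋃ B ∈ (HomFrag.spinal Y A 0 ω).classes,
          {D : Set ℕ | D.Nonempty ∧
            ∃ C ∈ (HomFrag.atTime (fun s => Y s ω)
              (HomFrag.exitTime A (sInf B) ω + t)).classes, D = C ∩ B}) ∧
    HomFrag.IsFragmentationGiven μ (HomFrag.spinalSigma Y A) (HomFrag.transitionKernel μ Y)
      (HomFrag.spinal Y A) := by
  obtain ⟨hP, 𝓕, hAm, hYm, hM, hI⟩ := hA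
  have ha := hY.branching.refining
  have hr := hY.branching.rightContinuous
  refine ⟨fun t ω => ⟨HomFrag.classes_spinal hP ha hr t ω,
    HomFrag.classes_spinal_eq_iUnion hP ha hr t ω⟩, ?_⟩
  have hG : HomFrag.IsGridSpine hY A := fun k =>
    ⟨_, haveI := hY.isProbabilityMeasure_map (HomFrag.mesh k)
      hY.isSpineChain hP hAm hYm hM hI (HomFrag.mesh k)⟩
  exact hG.isFragmentationGiven hP fun t => (hAm t).mono (𝓕.le t) le_rfl
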